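/- Consider the problem $$u_t(t,x)=u_x(t,x)+1_{(0,u(t,0))}(x)\quad (t,x>0),\qquad u(0,x)=u_0(x),\qquad u_0=1_{[0,1)},$$ where $u(t,0)=\lim_{x\to0^+}u(t,x)$. Its free boundary function is the function $\ell:[0,\infty)\to[0,\infty)$ of locally bounded variation such that $$\ell(t)=u_0(t)+|\{s\in[0,t]:\ \ell(t-s)>s\}|\qquad\text{for all } t\ge 0,$$ where $|\cdot|$ is Lebesgue measure. Its integral solution is the locally bounded function $v:\{0<\tau<\xi\}\to[0,\infty)$ for which the right traces $v(\tau,\tau):=\lim_{\xi\to\tau^+}v(\tau,\xi)\in[0,\infty)$ exist for all $\tau>0$ and $$v(\tau,\xi)=u_0(\xi)+\int_0^\tau 1_{(s,\,v(s,s)+s)}(\xi)\,ds\qquad\text{for all } 0<\tau<\xi ;$$ in the original variables the solution is $u(t,x)=v(t,t+x)$. For other initial data an integral solution is defined in the same way. Let $\alpha_n=\frac1{n+1}$, and define $T_n,M_n,t_n,m_n$ recursively by $T_0=M_0=t_0=0$, $m_0=1$, and, with $\Delta_n=(T_n+M_n)-(t_n+m_n)$, * if $\Delta_n\le 0$: $T_{n+1}=T_n+M_n+\delta_n$,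 $M_{n+1}=M_n+2\delta_n$, $t_{n+1}=t_n+m_n$, $m_{n+1}=m_n$, where $\delta_0=1$ and $\delta_n=0$ for $n\ge1$; * if $\Delta_n>0$: $T_{n+1}=t_n+m_n$, $M_{n+1}=M_n-\Delta_n\alpha_n$, $t_{n+1}=T_n+M_n$, $m_{n+1}=m_n+\Delta_n\alpha_{n+1}$. **Proposition (Asymptotic convergence to the stationary solution).** The free boundary function $\ell$ and the integral solution $v$ exist and are unique, and the following hold. 1. $m_n$ and $M_n$ are the successive local minima and local maxima of $\ell$: one has $t_n\to\infty$ and, for all $n\ge0$, $t_n<T_{n+1}\le t_{n+1}$, $\ell(t_n)=m_n$, $m_{n+1}<M_{n+1}$; $\ell$ is strictly increasing on $[t_n,T_{n+1})$ with left limit $M_{n+1}$ at $T_{n+1}$, and strictly decreasing on $[T_{n+1},t_{n+1}]$; if $T_{n+1}<t_{n+1}$ then $\ell(T_{n+1})=M_{n+1}$, while $T_{n+1}=t_{n+1}$ is a decreasing jump from $M_{n+1}$ to $m_{n+1}$. 2. $\lim_{n\to\infty}m_n=\lim_{n\to\infty}M_n=\sqrt2$. 3. $u_{\rm stat}(x)=\max\{\sqrt2-x,0\}$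 is the stationary solution with unit mass: the function $(\tau,\xi)\mapsto u_{\rm stat}(\xi-\tau)$ is an integral solution with initial datum $u_{\rm stat}$, $\int_0^\infty u_{\rm stat}\,dx=1$, and every function $f$ on $(0,\infty)$ with these two properties coincides with $u_{\rm stat}$ on $(0,\infty)$. 4. $\displaystyle\lim_{t\to+\infty}\|u(t,\cdot)-u_{\rm stat}\|_{L^\infty([0,+\infty))}=0$. -/

import Mathlib

open Set Filter Topology MeasureTheory

noncomputable section

namespace SingularTransport

/-- The Riemann datum, the characteristic function of `[0,1)`. -/
def riemannDatum (x : ℝ) : ℝ := (Ico (0 : ℝ) 1).indicator (fun _ => 1) x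

/-- `ℓ`, restricted to `[0,∞)`, is a nonnegative function of locally bounded (pointwise) variation
whose graph represents the free boundary of the problem with initial datum `u₀`:
`ℓ(t) = u₀(t) + |{s ∈ [0,t] : ℓ(t-s) > s}|` for all `t ≥ 0`. Only values on `[0,∞)` matter. -/
structure IsFreeBoundary (u₀ ℓ : ℝ → ℝ) : Prop where
  nonneg : ∀ t, 0 ≤ t → 0 ≤ ℓ t
  locallyBV : LocallyBoundedVariationOn ℓ (Ici 0)
  eqn : ∀ t, 0 ≤ t → ℓ t = u₀ t + volume.real {s : ℝ | s ∈ Icc 0 t ∧ s < ℓ (t - s)}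

/-- The open second octant in the characteristic coordinates `(τ, ξ) = (t, t + x)`. -/
def octant : Set (ℝ × ℝ) := {p | 0 < p.1 ∧ p.1 < p.2}

/-- `v`, restricted to the octant, is an integral solution with initial datum `u₀` of
`u_t = u_x + 1_{(0, u(t,0))}(x)`, written in the coordinates `(τ, ξ) = (t, t + x)`.
The function `w` is the right trace `w(τ) = lim_{ξ → τ⁺} v(τ, ξ)`, `τ > 0`. -/
structure IsIntegralSolution (u₀ : ℝ → ℝ) (v : ℝ → ℝ → ℝ) : Prop where
  nonneg : ∀ p ∈ octant, 0 ≤ v p.1 p.2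
  locallyBounded : ∀ p ∈ octant, ∃ C : ℝ, ∀ᶠ q in 𝓝 p, v q.1 q.2 ≤ C
  exists_trace : ∃ w : ℝ → ℝ,
    (∀ τ, 0 < τ → 0 ≤ w τ ∧ Tendsto (v τ) (𝓝[>] τ) (𝓝 (w τ))) ∧
    ∀ τ ξ, (τ, ξ) ∈ octant →
      IntervalIntegrable (fun s => (Ioo s (w s + s)).indicator (fun _ => (1 : ℝ)) ξ) volume 0 τ ∧
      v τ ξ = u₀ ξ + ∫ s in (0 : ℝ)..τ, (Ioo s (w s + s)).indicator (fun _ => (1 : ℝ)) ξ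

/-- The function in the original coordinates, `u(t, x) = v(t, t + x)`. -/
def physical (v : ℝ → ℝ → ℝ) (t x : ℝ) : ℝ := v t (t + x)

/-- The profile `max {√2 - x, 0}`. -/
def uStat (x : ℝ) : ℝ := max (Real.sqrt 2 - x) 0

/-- The profile `f : (0,∞) → ℝ` is stationary: `u(t, x) = f(x)`, that is `v(τ, ξ) = f(ξ - τ)`,
is an integral solution with initial datum `f`. -/
def IsStationary (f : ℝ → ℝ) : Prop := IsIntegralSolution f (fun τ ξ => f (ξ - τ))

/-- `f` has unit mass on the half-line. -/
def HasUnitMass (f : ℝ → ℝ) : Prop := IntegrableOn f (Ioi 0) ∧ ∫ x in Ioi (0 : ℝ), f x = 1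

/-! ### The recursive sequences of local extrema -/

/-- The slopes `α_n = 1 / (n + 1)`. -/
def slope (n : ℕ) : ℝ := 1 / ((n : ℝ) + 1)

/-- The abscissa `T` and value `M` of a local maximum, followed by the abscissa `t` and value `m`
of a local minimum. -/
structure ExtremalPair where
  T : ℝ
  M : ℝ
  t : ℝ
  m : ℝ

/-- The passage from `(T_n, M_n, t_n, m_n)` to `(T_{n+1}, M_{n+1}, t_{n+1}, m_{n+1})`. Here
`e.T + e.M = T*_{n+1}`, `e.t + e.m = t*_{n+1}`, and their difference is `Δ*_n`. -/
def nextPair (n : ℕ) (e : ExtremalPair) : ExtremalPair :=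
  let Δ : ℝ := (e.T + e.M) - (e.t + e.m)
  let δ : ℝ := if n = 0 then 1 else 0
  if Δ ≤ 0 then
    { T := e.T + e.M + δ
      M := e.M + 2 * δ
      t := e.t + e.m
      m := e.m }
  else
    { T := e.t + e.m
      M := e.M - Δ * slope n
      t := e.T + e.M
      m := e.m + Δ * slope (n + 1) }

/-- The sequence `(T_n, M_n, t_n, m_n)`, started at `(0, 0, 0, 1)`. -/
def pairs : ℕ → ExtremalPair
  | 0 => { T := 0, M := 0, t := 0, m := 1 }
  | n + 1 => nextPair n (pairs n)

/-- `T_n` -/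
def maxTime (n : ℕ) : ℝ := (pairs n).T

/-- `M_n` -/
def maxValue (n : ℕ) : ℝ := (pairs n).M

/-- `t_n` -/
def minTime (n : ℕ) : ℝ := (pairs n).t

/-- `m_n` -/
def minValue (n : ℕ) : ℝ := (pairs n).m

/-- The local extrema of `ℓ` on `[0,∞)` are, in alternating order, the minima `m n`, attained at
`t n`, and the maxima `M (n+1)`, at `T (n+1) ∈ (t n, t (n+1)]`: `ℓ` increases strictly from `m n` to
the left limit `M (n+1)` on `[t n, T (n+1))`, and decreases strictly from `M (n+1)` to `m (n+1)` on
`[T (n+1), t (n+1)]`. If `T (n+1) = t (n+1)` there is a decreasing jump at this point, where `ℓ`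
takes the smallest value `m (n+1)`, and `M (n+1)` is the largest value of the generalized graph. -/
structure HasAlternatingExtrema (ℓ : ℝ → ℝ) (t m T M : ℕ → ℝ) : Prop where
  t_zero : t 0 = 0
  t_lt_T : ∀ n, t n < T (n + 1)
  T_le_t : ∀ n, T (n + 1) ≤ t (n + 1)
  tendsto_t : Tendsto t atTop atTop
  apply_t : ∀ n, ℓ (t n) = m n
  increasing : ∀ n, StrictMonoOn ℓ (Ico (t n) (T (n + 1)))
  left_limit : ∀ n, Tendsto ℓ (𝓝[<] (T (n + 1))) (𝓝 (M (n + 1)))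
  apply_T : ∀ n, T (n + 1) < t (n + 1) → ℓ (T (n + 1)) = M (n + 1)
  decreasing : ∀ n, StrictAntiOn ℓ (Icc (T (n + 1)) (t (n + 1)))
  m_lt_M : ∀ n, m (n + 1) < M (n + 1)

end SingularTransport

end

noncomputable section

namespace SingularTransport

/-! ### The sequences of extrema -/

/-! Regard every time `r` as the birth of a cell that dies at the extinction time `r + ℓ r`. The
boundary equation then says that `ℓ t` is the datum plus the measure of the cells alive at `t`, so
the shape of `ℓ` dictates the later death rate. Where `ℓ` rises with slope `1/(n+1)`, the extinction
map has slope `(n+2)/(n+1)`; those cells die at rate `(n+1)/(n+2)` while births occur at rate 1, so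
the next rise has slope `1/(n+2)`. A fall lasts from the earlier to the later of the deaths of the
cells born at the previous maximum and minimum; the sign of `drop` says which comes first. This
gives the recursion, a piecewise affine candidate `freeBoundary`, and its verification by computing
the living cells on each piece (`volume_aliveSet_freeBoundary`).

Two conserved relations (`extremaInvariant`) control the extrema. The affine one says that the line
of slope `1/(n+1)` through `(t_n, m_n)` has height `M_n` at time `T_n + M_n`; it makes the pieces
fit and yields `M_n - m_n ≤ 2/(n+1)`. The other, `M_n m_n = 2`, is conservation of mass: `M_n m_n /
2` is the area under the residual lifetimes at `t_n`. Together they squeeze both sequences to `√2`.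

Uniqueness of `ℓ` needs only `freeBoundary ≥ 1`: over short time steps no newborn cell can die
(`eq_of_aliveSet_eqn`). The right trace of any integral solution satisfies the boundary equation
(`tendsto_integral_source`), so uniqueness and existence pass to `v`. Finally, `u(t,x)` counts the
cells dying after `t + x`; once `ℓ` is within `ε` of `√2`, this count is within `ε` of `max (√2 - x)
0`, uniformly in `x`. -/

lemma slope_pos (n : ℕ) : 0 < slope n := by unfold slope; positivity

lemma minTime_zero : minTime 0 = 0 := rfl
lemma minValue_zero : minValue 0 = 1 := rfl

lemma maxTime_one : maxTime 1 = 1 := by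
  norm_num [maxTime, pairs, nextPair]
lemma maxValue_one : maxValue 1 = 2 := by
  norm_num [maxValue, pairs, nextPair]
lemma minTime_one : minTime 1 = 1 := by
  norm_num [minTime, pairs, nextPair]
lemma minValue_one : minValue 1 = 1 := by
  norm_num [minValue, pairs, nextPair]

/-- The drop `Δ_n` of the extinction time between a maximum and the next minimum. -/
def drop (n : ℕ) : ℝ := (maxTime n + maxValue n) - (minTime n + minValue n)

/-- At `n = 0` the formula fails because of the extra term `δ_0 = 1`, which carries the initial
datum. -/
lemma maxTime_succ_of_drop_nonpos {n : ℕ} (hn : 1 ≤ n) (h : drop n ≤ 0) :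
    maxTime (n + 1) = maxTime n + maxValue n := by
  have h0 : n ≠ 0 := by omega
  unfold drop maxTime maxValue minTime minValue at h
  simp [maxTime, maxValue, pairs, nextPair, h, h0]

lemma maxValue_succ_of_drop_nonpos {n : ℕ} (hn : 1 ≤ n) (h : drop n ≤ 0) :
    maxValue (n + 1) = maxValue n := by
  have h0 : n ≠ 0 := by omega
  unfold drop maxTime maxValue minTime minValue at h
  simp [maxValue, pairs, nextPair, h, h0]

lemma minTime_succ_of_drop_nonpos {n : ℕ} (h : drop n ≤ 0) :
    minTime (n + 1) = minTime n + minValue n := by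
  unfold drop maxTime maxValue minTime minValue at h
  simp [minTime, minValue, pairs, nextPair, h]

lemma minValue_succ_of_drop_nonpos {n : ℕ} (h : drop n ≤ 0) :
    minValue (n + 1) = minValue n := by
  unfold drop maxTime maxValue minTime minValue at h
  simp [minValue, pairs, nextPair, h]

lemma maxTime_succ_of_drop_pos {n : ℕ} (h : 0 < drop n) :
    maxTime (n + 1) = minTime n + minValue n := by
  have h := not_le.2 h
  unfold drop maxTime maxValue minTime minValue at h
  simp only [maxTime, minTime, minValue, pairs, nextPair, if_neg h]

lemma maxValue_succ_of_drop_pos {n : ℕ} (h : 0 < drop n) :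
    maxValue (n + 1) = maxValue n - drop n * slope n := by
  have h := not_le.2 h
  unfold drop maxTime maxValue minTime minValue at h
  simp only [drop, maxTime, maxValue, minTime, minValue, pairs, nextPair, if_neg h]

lemma minTime_succ_of_drop_pos {n : ℕ} (h : 0 < drop n) :
    minTime (n + 1) = maxTime n + maxValue n := by
  have h := not_le.2 h
  unfold drop maxTime maxValue minTime minValue at h
  simp only [maxTime, maxValue, minTime, pairs, nextPair, if_neg h]

lemma minValue_succ_of_drop_pos {n : ℕ} (h : 0 < drop n) :
    minValue (n + 1) = minValue n + drop n * slope (n + 1) := by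
  have h := not_le.2 h
  unfold drop maxTime maxValue minTime minValue at h
  simp only [drop, maxTime, maxValue, minTime, minValue, pairs, nextPair, if_neg h]

/-- The algebraic relations and bounds preserved by the recursion. -/
structure ExtremaInvariant (n : ℕ) : Prop where
  one_le_min : 1 ≤ minValue n
  min_lt_max : minValue n < maxValue n
  max_le_two : maxValue n ≤ 2
  time_le : maxTime n ≤ minTime n
  time_le_add_one : minTime n ≤ maxTime n + 1
  affine : ((n : ℝ) + 1) * (maxValue n - minValue n) = maxValue n - (minTime n - maxTime n)
  mass : maxValue n * minValue n = 2

/-- For `drop n ≤ 0` the values do not change and only the times move. For `drop n > 0` the relation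
`T_n ≤ t_n` gives `drop n ≤ M_n - m_n`; the gap between maximum and minimum shrinks by at most the
fraction `1/2 + 1/3 < 1` of itself and stays positive. -/
lemma extremaInvariant_succ {n : ℕ} (hn : 1 ≤ n) (h : ExtremaInvariant n) :
    ExtremaInvariant (n + 1) := by
  obtain ⟨h1, h2, h3, h4, h5, h6, h7⟩ := h
  have hn' : (1 : ℝ) ≤ n := by exact_mod_cast hn
  rcases le_or_gt (drop n) 0 with hd | hd
  · have e1 := maxTime_succ_of_drop_nonpos hn hd
    have e2 := maxValue_succ_of_drop_nonpos hn hd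
    have e3 := minTime_succ_of_drop_nonpos hd
    have e4 := minValue_succ_of_drop_nonpos hd
    unfold drop at hd
    constructor <;> simp only [e1, e2, e3, e4] <;> push_cast <;> linarith
  · have e1 := maxTime_succ_of_drop_pos hd
    have e2 := maxValue_succ_of_drop_pos hd
    have e3 := minTime_succ_of_drop_pos hd
    have e4 := minValue_succ_of_drop_pos hd
    have hle : drop n ≤ maxValue n - minValue n := by unfold drop; linarith
    have hs : slope n ≤ 1 / 2 := by
      unfold slope
      rw [div_le_div_iff₀ (by positivity) (by positivity)]; linarith
    have hs' : slope (n + 1) ≤ 1 / 3 := by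
      unfold slope; push_cast
      rw [div_le_div_iff₀ (by positivity) (by positivity)]; linarith
    have p := slope_pos n
    have p' := slope_pos (n + 1)
    have q : ((n : ℝ) + 1) * slope n = 1 := by unfold slope; field_simp
    have q' : ((n : ℝ) + 2) * slope (n + 1) = 1 := by
      unfold slope; push_cast; field_simp; ring
    have i1 : 0 < drop n * slope n := by positivity
    have i2 : 0 < drop n * slope (n + 1) := by positivity
    have i3 : drop n * slope n ≤ drop n * (1 / 2) := by gcongr
    have i4 : drop n * slope (n + 1) ≤ drop n * (1 / 3) := by gcongr
    have hD : drop n = (maxTime n + maxValue n) - (minTime n + minValue n) := rfl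
    have hm1 : maxValue n - minValue n ≤ 1 := by linarith
    constructor
    · linarith
    · linarith
    · linarith
    · linarith
    · linarith
    · rw [e1, e2, e3, e4]; push_cast
      generalize drop n = D at *
      have a1 : D * slope n * (n + 1) = D := by linear_combination D * q
      have a2 : D * slope (n + 1) * (n + 2) = D := by linear_combination D * q'
      linear_combination h6 - a1 - a2 - 2 * hD
    · rw [e2, e4]
      have a1 : ((n : ℝ) + 1) ≠ 0 := by positivity
      have a2 : ((n : ℝ) + 2) ≠ 0 := by positivity
      -- Expanding `M_{n+1} m_{n+1} - M_n m_n` leaves `drop n` times this expression, which vanishes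
      -- by the affine relation.
      have key : maxValue n * slope (n + 1) - minValue n * slope n
          - drop n * slope n * slope (n + 1) = 0 := by
        have hs1 : slope n = 1 / (n + 1) := rfl
        have hs2 : slope (n + 1) = 1 / (n + 2) := by
          unfold slope; push_cast; ring
        rw [hs1, hs2, hD]
        field_simp
        linear_combination h6
      linear_combination h7 + drop n * key

lemma extremaInvariant {n : ℕ} (hn : 1 ≤ n) : ExtremaInvariant n := by
  induction n, hn using Nat.le_induction with
  | base =>
    constructor <;> norm_num [maxTime_one, maxValue_one, minTime_one, minValue_one]
  | succ n hn ih => exact extremaInvariant_succ hn ih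

lemma one_le_minValue (n : ℕ) : 1 ≤ minValue n := by
  rcases Nat.eq_zero_or_pos n with rfl | h
  · exact le_rfl
  · exact (extremaInvariant h).one_le_min

/-- Values on a rising interval, written from its right end. -/
lemma maxValue_succ_eq (n : ℕ) :
    maxValue (n + 1) = minValue n + slope n * (maxTime (n + 1) - minTime n) := by
  rcases Nat.eq_zero_or_pos n with rfl | hn
  · norm_num [maxTime_one, maxValue_one, minTime_zero, minValue_zero, slope]
  · have h := (extremaInvariant hn).affine
    have q : ((n : ℝ) + 1) * slope n = 1 := by unfold slope; field_simp
    rcases le_or_gt (drop n) 0 with hd | hd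
    · rw [maxTime_succ_of_drop_nonpos hn hd, maxValue_succ_of_drop_nonpos hn hd]
      linear_combination slope n * h - (maxValue n - minValue n) * q
    · rw [maxTime_succ_of_drop_pos hd, maxValue_succ_of_drop_pos hd]
      unfold drop
      linear_combination slope n * h - (maxValue n - minValue n) * q

lemma minTime_lt_maxTime_succ (n : ℕ) : minTime n < maxTime (n + 1) := by
  rcases Nat.eq_zero_or_pos n with rfl | hn
  · norm_num [maxTime_one, minTime_zero]
  · have h := extremaInvariant hn
    rcases le_or_gt (drop n) 0 with hd | hd
    · rw [maxTime_succ_of_drop_nonpos hn hd]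
      linarith [h.one_le_min, h.min_lt_max, h.time_le_add_one]
    · rw [maxTime_succ_of_drop_pos hd]
      linarith [h.one_le_min]

lemma maxTime_succ_le_minTime_succ (n : ℕ) : maxTime (n + 1) ≤ minTime (n + 1) :=
  (extremaInvariant (Nat.succ_pos n)).time_le

lemma minTime_lt_succ (n : ℕ) : minTime n < minTime (n + 1) :=
  (minTime_lt_maxTime_succ n).trans_le (maxTime_succ_le_minTime_succ n)

lemma minTime_strictMono : StrictMono minTime := strictMono_nat_of_lt_succ minTime_lt_succ

/-- Cells born at a minimum become extinct during the next falling interval. -/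
lemma min_extinction_mem (n : ℕ) :
    minTime n + minValue n ∈ Icc (maxTime (n + 1)) (minTime (n + 1)) := by
  rcases Nat.eq_zero_or_pos n with rfl | hn
  · norm_num [maxTime_one, minTime_one, minTime_zero, minValue_zero]
  · rcases le_or_gt (drop n) 0 with hd | hd
    · rw [maxTime_succ_of_drop_nonpos hn hd, minTime_succ_of_drop_nonpos hd]
      unfold drop at hd
      constructor <;> linarith
    · rw [maxTime_succ_of_drop_pos hd, minTime_succ_of_drop_pos hd]
      unfold drop at hd
      constructor <;> linarith

/-- Cells born at a maximum become extinct during the next falling interval. -/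
lemma max_extinction_mem {n : ℕ} (hn : 1 ≤ n) :
    maxTime n + maxValue n ∈ Icc (maxTime (n + 1)) (minTime (n + 1)) := by
  rcases le_or_gt (drop n) 0 with hd | hd
  · rw [maxTime_succ_of_drop_nonpos hn hd, minTime_succ_of_drop_nonpos hd]
    unfold drop at hd
    constructor <;> linarith
  · rw [maxTime_succ_of_drop_pos hd, minTime_succ_of_drop_pos hd]
    unfold drop at hd
    constructor <;> linarith

/-! ### Divergence of the times and limits of the extremal values -/

lemma natCast_le_minTime (n : ℕ) : (n : ℝ) ≤ minTime n := by
  induction n with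
  | zero => simp [minTime_zero]
  | succ n ih =>
    push_cast
    linarith [(min_extinction_mem n).2, one_le_minValue n]

lemma tendsto_minTime : Tendsto minTime atTop atTop :=
  tendsto_atTop_mono natCast_le_minTime tendsto_natCast_atTop_atTop

lemma max_sub_min_le {n : ℕ} (hn : 1 ≤ n) :
    maxValue n - minValue n ≤ 2 / ((n : ℝ) + 1) := by
  have h := extremaInvariant hn
  rw [le_div_iff₀ (by positivity)]
  linarith [h.affine, h.time_le, h.max_le_two]

/-- Since `m_n M_n = 2` and `m_n < M_n`, the number `√2` separates the two values. -/
lemma minValue_le_sqrt_two (n : ℕ) : minValue n ≤ √2 := by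
  rcases Nat.eq_zero_or_pos n with rfl | hn
  · rw [minValue_zero]; exact Real.one_le_sqrt.2 (by norm_num)
  · have h := extremaInvariant hn
    apply Real.le_sqrt_of_sq_le
    nlinarith [h.mass, h.one_le_min, h.min_lt_max]

lemma sqrt_two_le_maxValue {n : ℕ} (hn : 1 ≤ n) : √2 ≤ maxValue n := by
  have h := extremaInvariant hn
  apply Real.sqrt_le_iff.2 ⟨by linarith [h.one_le_min, h.min_lt_max], ?_⟩
  nlinarith [h.mass, h.one_le_min, h.min_lt_max]

lemma tendsto_two_div : Tendsto (fun n : ℕ => 2 / ((n : ℝ) + 1)) atTop (𝓝 0) := by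
  simpa [div_eq_mul_inv] using (tendsto_one_div_add_atTop_nhds_zero_nat (𝕜 := ℝ)).const_mul 2

lemma tendsto_maxValue : Tendsto maxValue atTop (𝓝 √2) := by
  have h : Tendsto (fun n : ℕ => √2 + 2 / ((n : ℝ) + 1)) atTop (𝓝 √2) := by
    simpa using tendsto_two_div.const_add √2
  refine tendsto_of_tendsto_of_tendsto_of_le_of_le' tendsto_const_nhds h ?_ ?_
  · filter_upwards [eventually_ge_atTop 1] with n hn using sqrt_two_le_maxValue hn
  · filter_upwards [eventually_ge_atTop 1] with n hn
    linarith [max_sub_min_le hn, minValue_le_sqrt_two n]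

lemma tendsto_minValue : Tendsto minValue atTop (𝓝 √2) := by
  have h : Tendsto (fun n : ℕ => √2 - 2 / ((n : ℝ) + 1)) atTop (𝓝 √2) := by
    simpa using tendsto_two_div.const_sub √2
  refine tendsto_of_tendsto_of_tendsto_of_le_of_le' h tendsto_const_nhds ?_ ?_
  · filter_upwards [eventually_ge_atTop 1] with n hn
    linarith [max_sub_min_le hn, sqrt_two_le_maxValue hn]
  · exact Eventually.of_forall minValue_le_sqrt_two

/-! ### The explicit free boundary -/

lemma exists_lt_minTime_succ (t : ℝ) : ∃ n, t < minTime (n + 1) := by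
  obtain ⟨n, hn⟩ := exists_nat_gt t
  exact ⟨n, hn.trans_le ((natCast_le_minTime n).trans (minTime_lt_succ n).le)⟩

/-- The affine pieces of the free boundary between the minima `t_n` and `t_{n+1}`. -/
def boundaryPiece (n : ℕ) (t : ℝ) : ℝ :=
  if t < maxTime (n + 1) then minValue n + slope n * (t - minTime n)
  -- When `T_{n+1} = t_{n+1}` the divisor below is zero, but this branch is then empty on `[t_n,
  -- t_{n+1})`: the fall is a jump.
  else maxValue (n + 1) - (t - maxTime (n + 1)) *
    ((maxValue (n + 1) - minValue (n + 1)) / (minTime (n + 1) - maxTime (n + 1)))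

open Classical in
/-- The piecewise affine function with the prescribed alternating extrema. -/
def freeBoundary (t : ℝ) : ℝ := boundaryPiece (Nat.find (exists_lt_minTime_succ t)) t

lemma measurable_freeBoundary : Measurable freeBoundary := by
  classical
  unfold freeBoundary
  refine Measurable.find (f := boundaryPiece) (p := fun n t => t < minTime (n + 1))
    (fun n => ?_) (fun n => ?_) exists_lt_minTime_succ
  · unfold boundaryPiece
    exact Measurable.ite measurableSet_Iio (by fun_prop) (by fun_prop)
  · exact measurableSet_Iio

lemma freeBoundary_eq_piece {n : ℕ} {t : ℝ} (h : t ∈ Ico (minTime n) (minTime (n + 1))) :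
    freeBoundary t = boundaryPiece n t := by
  classical
  unfold freeBoundary
  congr 1
  refine (Nat.find_eq_iff _).2 ⟨h.2, fun k hk => ?_⟩
  exact not_lt.2 ((minTime_strictMono.monotone hk).trans h.1)

lemma exists_mem_Ico_minTime {t : ℝ} (ht : 0 ≤ t) :
    ∃ n, t ∈ Ico (minTime n) (minTime (n + 1)) := by
  classical
  have h := exists_lt_minTime_succ t
  refine ⟨Nat.find h, ?_, Nat.find_spec h⟩
  rcases Nat.eq_zero_or_pos (Nat.find h) with h0 | h0
  · rw [h0]; exact ht
  · have := Nat.find_min h (Nat.sub_lt h0 one_pos)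
    rwa [Nat.sub_add_cancel (show 1 ≤ Nat.find h from h0), not_lt] at this

lemma freeBoundary_rising {n : ℕ} {t : ℝ} (h : t ∈ Ico (minTime n) (maxTime (n + 1))) :
    freeBoundary t = minValue n + slope n * (t - minTime n) := by
  rw [freeBoundary_eq_piece ⟨h.1, h.2.trans_le (maxTime_succ_le_minTime_succ n)⟩, boundaryPiece,
    if_pos h.2]

lemma freeBoundary_rising' {n : ℕ} {t : ℝ} (h : t ∈ Ico (minTime n) (maxTime (n + 1))) :
    freeBoundary t = maxValue (n + 1) - slope n * (maxTime (n + 1) - t) := by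
  rw [freeBoundary_rising h, maxValue_succ_eq]; ring

lemma freeBoundary_minTime (n : ℕ) : freeBoundary (minTime n) = minValue n := by
  rw [freeBoundary_rising ⟨le_rfl, minTime_lt_maxTime_succ n⟩]; ring

lemma freeBoundary_falling {n : ℕ} {t : ℝ} (h : t ∈ Icc (maxTime (n + 1)) (minTime (n + 1)))
    (hlt : maxTime (n + 1) < minTime (n + 1)) :
    freeBoundary t = maxValue (n + 1) - (t - maxTime (n + 1)) *
      ((maxValue (n + 1) - minValue (n + 1)) / (minTime (n + 1) - maxTime (n + 1))) := by
  rcases h.2.lt_or_eq with h2 | h2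
  · rw [freeBoundary_eq_piece ⟨(minTime_lt_maxTime_succ n).le.trans h.1, h2⟩, boundaryPiece,
      if_neg (not_lt.2 h.1)]
  -- The right end already belongs to the next piece, whose initial value is the one the falling
  -- formula predicts.
  · rw [h2, freeBoundary_minTime, mul_div_cancel₀]
    · ring
    · linarith

lemma minValue_succ_lt_maxValue_succ (n : ℕ) : minValue (n + 1) < maxValue (n + 1) :=
  (extremaInvariant (Nat.succ_pos n)).min_lt_max

lemma minValue_le_succ (n : ℕ) : minValue n ≤ minValue (n + 1) := by
  rcases le_or_gt (drop n) 0 with hd | hd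
  · rw [minValue_succ_of_drop_nonpos hd]
  · rw [minValue_succ_of_drop_pos hd]
    have := slope_pos (n + 1)
    have : 0 < drop n * slope (n + 1) := by positivity
    linarith

lemma freeBoundary_mem_Icc {n : ℕ} {t : ℝ} (h : t ∈ Ico (minTime n) (minTime (n + 1))) :
    freeBoundary t ∈ Icc (minValue n) (maxValue (n + 1)) := by
  have hs := slope_pos n
  rcases lt_or_ge t (maxTime (n + 1)) with h1 | h1
  · constructor
    · rw [freeBoundary_rising ⟨h.1, h1⟩]
      have : 0 ≤ slope n * (t - minTime n) := mul_nonneg hs.le (by linarith [h.1])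
      linarith
    · rw [freeBoundary_rising' ⟨h.1, h1⟩]
      have : 0 ≤ slope n * (maxTime (n + 1) - t) := mul_nonneg hs.le (by linarith)
      linarith
  · have hlt := h1.trans_lt h.2
    have hm := minValue_succ_lt_maxValue_succ n
    rw [freeBoundary_falling ⟨h1, h.2.le⟩ hlt]
    set D := (maxValue (n + 1) - minValue (n + 1)) / (minTime (n + 1) - maxTime (n + 1)) with hD
    have hD0 : 0 ≤ D := div_nonneg (by linarith) (by linarith)
    have e : (minTime (n + 1) - maxTime (n + 1)) * D = maxValue (n + 1) - minValue (n + 1) :=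
      mul_div_cancel₀ _ (by linarith)
    have a1 : 0 ≤ (t - maxTime (n + 1)) * D := mul_nonneg (by linarith) hD0
    have a2 : 0 ≤ (minTime (n + 1) - t) * D := mul_nonneg (by linarith [h.2]) hD0
    constructor
    · linarith [minValue_le_succ n]
    · linarith

lemma one_le_freeBoundary {t : ℝ} (ht : 0 ≤ t) : 1 ≤ freeBoundary t := by
  obtain ⟨n, hn⟩ := exists_mem_Ico_minTime ht
  exact (one_le_minValue n).trans (freeBoundary_mem_Icc hn).1

lemma freeBoundary_le_two {t : ℝ} (ht : 0 ≤ t) : freeBoundary t ≤ 2 := by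
  obtain ⟨n, hn⟩ := exists_mem_Ico_minTime ht
  exact (freeBoundary_mem_Icc hn).2.trans (extremaInvariant (Nat.succ_pos n)).max_le_two

lemma tendsto_freeBoundary : Tendsto freeBoundary atTop (𝓝 √2) := by
  rw [Metric.tendsto_atTop]
  intro ε hε
  have h1 := (Metric.tendsto_atTop.1 tendsto_minValue) ε hε
  have h2 := (Metric.tendsto_atTop.1 tendsto_maxValue) ε hε
  obtain ⟨N1, h1⟩ := h1
  obtain ⟨N2, h2⟩ := h2
  refine ⟨minTime (max N1 N2), fun t ht => ?_⟩
  have ht0 : 0 ≤ t := (Nat.cast_nonneg _).trans ((natCast_le_minTime _).trans ht)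
  obtain ⟨n, hn⟩ := exists_mem_Ico_minTime ht0
  have hN : max N1 N2 ≤ n := by
    have := minTime_strictMono.lt_iff_lt.1 (ht.trans_lt hn.2)
    omega
  have a1 := h1 n ((le_max_left _ _).trans hN)
  have a2 := h2 (n + 1) ((le_max_right _ _).trans (hN.trans n.le_succ))
  rw [Real.dist_eq, abs_lt] at *
  have := freeBoundary_mem_Icc hn
  constructor <;> linarith [this.1, this.2]

/-! ### Extinction times -/

/-- The extinction map is affine here with slope `1 + slope n`, whose inverse is `1 - slope (n +
1)`. The threshold is the birth time of the cell dying at `t`, measured back from the maximum. -/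
lemma extinction_rising {n : ℕ} {r t : ℝ} (h : r ∈ Ico (minTime n) (maxTime (n + 1))) :
    t < r + freeBoundary r ↔
      maxTime (n + 1) - (maxTime (n + 1) + maxValue (n + 1) - t) * (1 - slope (n + 1)) < r := by
  rw [freeBoundary_rising' h]
  have e : (1 - slope (n + 1)) * (1 + slope n) = 1 := by
    unfold slope; push_cast; field_simp; ring
  have hp : 0 < 1 + slope n := by linarith [slope_pos n]
  have hq : 0 < 1 - slope (n + 1) := pos_of_mul_pos_left (e.symm ▸ one_pos) hp.le
  constructor
  · intro h1
    have := mul_lt_mul_of_pos_right (sub_pos.2 h1) hq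
    have e2 : (r + (maxValue (n + 1) - slope n * (maxTime (n + 1) - r)) - t) * (1 - slope (n + 1))
      = r - (maxTime (n + 1) - (maxTime (n + 1) + maxValue (n + 1) - t) * (1 - slope (n + 1))) := by
      linear_combination (r - maxTime (n + 1)) * e
    rw [e2] at this
    linarith
  · intro h1
    have := mul_lt_mul_of_pos_right (sub_pos.2 h1) hp
    have e2 : (r - (maxTime (n + 1) - (maxTime (n + 1) + maxValue (n + 1) - t)
        * (1 - slope (n + 1)))) * (1 + slope n)
      = (r + (maxValue (n + 1) - slope n * (maxTime (n + 1) - r)) - t)  := by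
      linear_combination (maxTime (n + 1) + maxValue (n + 1) - t) * e
    rw [e2] at this
    linarith

/-- Along a fall the extinction time runs affinely from `T + M` to `t + m`, a total descent of
`drop`, which may be negative. -/
lemma extinction_falling {n : ℕ} {r : ℝ} (h : r ∈ Ico (maxTime (n + 1)) (minTime (n + 1))) :
    r + freeBoundary r = maxTime (n + 1) + maxValue (n + 1) - (r - maxTime (n + 1)) *
      (drop (n + 1) / (minTime (n + 1) - maxTime (n + 1))) := by
  have hlt := h.1.trans_lt h.2
  rw [freeBoundary_falling ⟨h.1, h.2.le⟩ hlt]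
  have : minTime (n + 1) - maxTime (n + 1) ≠ 0 := by linarith
  unfold drop
  field_simp
  ring

/-- The extinction times of the cells born between two minima. -/
lemma extinction_mem {n : ℕ} {r : ℝ} (h : r ∈ Ico (minTime n) (minTime (n + 1))) :
    r + freeBoundary r ∈ Icc (maxTime (n + 1)) (minTime (n + 2)) := by
  have hs := slope_pos n
  have h3 := minTime_lt_maxTime_succ (n + 1)
  have h4 := maxTime_succ_le_minTime_succ n
  have h5 := max_extinction_mem (Nat.succ_pos n)
  rcases lt_or_ge r (maxTime (n + 1)) with h1 | h1
  · constructor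
    · rw [freeBoundary_rising ⟨h.1, h1⟩]
      have : 0 ≤ slope n * (r - minTime n) := mul_nonneg hs.le (by linarith [h.1])
      linarith [(min_extinction_mem n).1, h.1]
    · rw [freeBoundary_rising' ⟨h.1, h1⟩]
      have : 0 ≤ slope n * (maxTime (n + 1) - r) := mul_nonneg hs.le (by linarith)
      linarith [h5.2]
  · have hlt := h1.trans_lt h.2
    have h6 := min_extinction_mem (n + 1)
    rw [extinction_falling ⟨h1, h.2⟩]
    set D := drop (n + 1) / (minTime (n + 1) - maxTime (n + 1)) with hD
    have e : (minTime (n + 1) - maxTime (n + 1)) * D = drop (n + 1) :=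
      mul_div_cancel₀ _ (by linarith)
    unfold drop at e
    have k1 : 0 ≤ r - maxTime (n + 1) := by linarith
    have k2 : 0 ≤ minTime (n + 1) - r := by linarith [h.2]
    have h51 := h5.1
    have h52 := h5.2
    have h61 := h6.1
    have h62 := h6.2
    simp only [Nat.succ_eq_add_one] at h51 h52
    -- An affine function lies between its end values; the sign of `D` decides which of them is the
    -- larger.
    rcases le_total 0 D with hD0 | hD0
    · have a1 : 0 ≤ (r - maxTime (n + 1)) * D := mul_nonneg k1 hD0
      have a2 : 0 ≤ (minTime (n + 1) - r) * D := mul_nonneg k2 hD0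
      constructor <;> linarith
    · have a1 : (r - maxTime (n + 1)) * D ≤ 0 := mul_nonpos_of_nonneg_of_nonpos k1 hD0
      have a2 : (minTime (n + 1) - r) * D ≤ 0 := mul_nonpos_of_nonneg_of_nonpos k2 hD0
      constructor <;> linarith

lemma extinction_falling_ge {n : ℕ} {r : ℝ} (h : r ∈ Ico (maxTime (n + 1)) (minTime (n + 1))) :
    maxTime (n + 2) ≤ r + freeBoundary r := by
  have hlt := h.1.trans_lt h.2
  have h51 := (max_extinction_mem (Nat.succ_pos n)).1
  have h61 := (min_extinction_mem (n + 1)).1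
  simp only [Nat.succ_eq_add_one] at h51
  rw [extinction_falling h]
  set D := drop (n + 1) / (minTime (n + 1) - maxTime (n + 1)) with hD
  have e : (minTime (n + 1) - maxTime (n + 1)) * D = drop (n + 1) :=
    mul_div_cancel₀ _ (by linarith)
  unfold drop at e
  have k1 : 0 ≤ r - maxTime (n + 1) := by linarith [h.1]
  have k2 : 0 ≤ minTime (n + 1) - r := by linarith [h.2]
  rcases le_total 0 D with hD0 | hD0
  · have a2 : 0 ≤ (minTime (n + 1) - r) * D := mul_nonneg k2 hD0
    linarith
  · have a1 : (r - maxTime (n + 1)) * D ≤ 0 := mul_nonpos_of_nonneg_of_nonpos k1 hD0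
    linarith

lemma hasAlternatingExtrema_freeBoundary :
    HasAlternatingExtrema freeBoundary minTime minValue maxTime maxValue where
  t_zero := rfl
  t_lt_T := minTime_lt_maxTime_succ
  T_le_t := maxTime_succ_le_minTime_succ
  tendsto_t := tendsto_minTime
  apply_t := freeBoundary_minTime
  increasing n := by
    intro r hr s hs hrs
    rw [freeBoundary_rising hr, freeBoundary_rising hs]
    have := slope_pos n
    gcongr
  left_limit n := by
    have h : Tendsto (fun t => maxValue (n + 1) - slope n * (maxTime (n + 1) - t))
        (𝓝[<] (maxTime (n + 1))) (𝓝 (maxValue (n + 1))) := by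
      have hc : Continuous fun t => maxValue (n + 1) - slope n * (maxTime (n + 1) - t) := by
        fun_prop
      have := (hc.tendsto (maxTime (n + 1))).mono_left
        (nhdsWithin_le_nhds (s := Iio (maxTime (n + 1))))
      simpa using this
    refine h.congr' ?_
    filter_upwards [Ico_mem_nhdsLT (minTime_lt_maxTime_succ n)] with t ht
    exact (freeBoundary_rising' ht).symm
  apply_T n h := by
    rw [freeBoundary_falling ⟨le_rfl, h.le⟩ h]; ring
  decreasing n := by
    intro r hr s hs hrs
    have hlt : maxTime (n + 1) < minTime (n + 1) := hr.1.trans_lt (hrs.trans_le hs.2)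
    rw [freeBoundary_falling hr hlt, freeBoundary_falling hs hlt]
    have : 0 < (maxValue (n + 1) - minValue (n + 1)) / (minTime (n + 1) - maxTime (n + 1)) :=
      div_pos (sub_pos.2 (minValue_succ_lt_maxValue_succ n)) (sub_pos.2 hlt)
    gcongr
  m_lt_M := minValue_succ_lt_maxValue_succ

/-! ### The free boundary equation -/

/-- The birth times `r ∈ [0,t]` of the cells whose extinction time `r + ℓ(r)` exceeds `t`. -/
def aliveSet (ℓ : ℝ → ℝ) (t : ℝ) : Set ℝ := {r | r ∈ Icc 0 t ∧ t < r + ℓ r}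

lemma aliveSet_subset (ℓ : ℝ → ℝ) (t : ℝ) : aliveSet ℓ t ⊆ Icc 0 t := fun _ h => h.1

lemma volume_aliveSet_ne_top (ℓ : ℝ → ℝ) (t : ℝ) : volume (aliveSet ℓ t) ≠ ⊤ :=
  measure_ne_top_of_subset (aliveSet_subset ℓ t) (by simp)

lemma volume_eq_aliveSet (ℓ : ℝ → ℝ) (t : ℝ) :
    volume.real {s : ℝ | s ∈ Icc 0 t ∧ s < ℓ (t - s)} = volume.real (aliveSet ℓ t) := by
  have h : {s : ℝ | s ∈ Icc 0 t ∧ s < ℓ (t - s)}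
      = Neg.neg ⁻¹' ((fun x => t + x) ⁻¹' aliveSet ℓ t) := by
    ext s
    simp only [aliveSet, mem_preimage, mem_Icc, mem_ofPred_eq, ← sub_eq_add_neg]
    constructor
    · rintro ⟨⟨h1, h2⟩, h3⟩; exact ⟨⟨by linarith, by linarith⟩, by linarith⟩
    · rintro ⟨⟨h1, h2⟩, h3⟩; exact ⟨⟨by linarith, by linarith⟩, by linarith⟩
  rw [measureReal_def, measureReal_def, h, Measure.measure_preimage_neg, measure_preimage_add]

/-! ### Living cells of the explicit boundary -/

lemma slope_succ_lt_one (n : ℕ) : slope (n + 1) < 1 := by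
  unfold slope; push_cast
  rw [div_lt_one (by positivity)]
  have : (0 : ℝ) ≤ n := n.cast_nonneg
  linarith

lemma extinction_le_of_lt_minTime {n : ℕ} {r : ℝ} (h0 : 0 ≤ r) (h : r < minTime n) :
    r + freeBoundary r ≤ minTime (n + 1) := by
  obtain ⟨k, hk⟩ := exists_mem_Ico_minTime h0
  have hkn : k < n := minTime_strictMono.lt_iff_lt.1 (hk.1.trans_lt h)
  exact (extinction_mem hk).2.trans (minTime_strictMono.monotone (by omega))

/-- During a rise only cells of the previous rise are dying, in order of birth. Earlier cells are
all dead, and those born from `T_{n+1}` on survive at least until `T_{n+2}`. -/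
lemma aliveSet_of_mem_rising {n : ℕ} {t : ℝ} (h : t ∈ Ico (minTime (n + 1)) (maxTime (n + 2))) :
    aliveSet freeBoundary t =
      Ioc (maxTime (n + 1) - (maxTime (n + 1) + maxValue (n + 1) - t) * (1 - slope (n + 1))) t := by
  set c := (maxTime (n + 1) + maxValue (n + 1) - t) * (1 - slope (n + 1)) with hc
  have hb := (max_extinction_mem (Nat.succ_pos n)).1
  have hs := slope_succ_lt_one n
  have hc0 : 0 < c := mul_pos (by linarith [h.2]) (by linarith)
  have hn0 : 0 ≤ minTime n := n.cast_nonneg.trans (natCast_le_minTime n)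
  have h1 := minTime_lt_maxTime_succ n
  -- Otherwise the cell born at `t_n` would still be alive at `t`, although it dies by `t_{n+1}`.
  have hr0 : minTime n ≤ maxTime (n + 1) - c := by
    by_contra! hlt
    have := (extinction_rising (t := t) ⟨le_rfl, h1⟩).2 hlt
    rw [freeBoundary_minTime] at this
    linarith [(min_extinction_mem n).2, h.1]
  ext r
  constructor
  · rintro ⟨⟨hr, hrt⟩, hl⟩
    refine ⟨?_, hrt⟩
    rcases lt_or_ge r (minTime n) with hA | hA
    · linarith [extinction_le_of_lt_minTime hr hA, h.1]
    rcases lt_or_ge r (maxTime (n + 1)) with hB | hB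
    · exact (extinction_rising ⟨hA, hB⟩).1 hl
    · linarith
  · rintro ⟨hr, hrt⟩
    refine ⟨⟨by linarith, hrt⟩, ?_⟩
    rcases lt_or_ge r (maxTime (n + 1)) with hB | hB
    · exact (extinction_rising ⟨by linarith, hB⟩).2 hr
    rcases lt_or_ge r (minTime (n + 1)) with hC | hC
    · linarith [extinction_falling_ge ⟨hB, hC⟩, h.2]
    · have := (extinction_mem (n := n + 1) (r := r)
        ⟨hC, by linarith [maxTime_succ_le_minTime_succ (n + 1), h.2]⟩).1
      linarith [h.2]

/-- The previous rise has died out, and extinction times increase along the previous fall, so its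
cells die in order of birth and the living cells form one interval. -/
lemma aliveSet_of_mem_falling_of_drop_nonpos {n : ℕ} {t : ℝ}
    (h : t ∈ Ico (maxTime (n + 2)) (minTime (n + 2))) (hd : drop (n + 1) ≤ 0) :
    aliveSet freeBoundary t =
      Ioc (maxTime (n + 1) + (t - (maxTime (n + 1) + maxValue (n + 1))) *
        ((minTime (n + 1) - maxTime (n + 1)) / -drop (n + 1))) t := by
  have eT := maxTime_succ_of_drop_nonpos (Nat.succ_pos n) hd
  have et := minTime_succ_of_drop_nonpos hd
  simp only [Nat.succ_eq_add_one, add_assoc, Nat.reduceAdd] at eT et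
  have hx0 := maxTime_succ_le_minTime_succ n
  have hD : drop (n + 1) = maxTime (n + 1) + maxValue (n + 1)
    - (minTime (n + 1) + minValue (n + 1)) := rfl
  have hn0 : 0 ≤ minTime n := n.cast_nonneg.trans (natCast_le_minTime n)
  have h1 := minTime_lt_maxTime_succ n
  have h2 := minTime_lt_maxTime_succ (n + 1)
  have hm := minValue_succ_lt_maxValue_succ n
  have hs := slope_succ_lt_one n
  -- The present fall has length `-drop (n + 1)` and contains `t`, which excludes the jump case.
  have hdn : drop (n + 1) < 0 := by linarith [h.1.trans_lt h.2]
  have hx : 0 < minTime (n + 1) - maxTime (n + 1) := by linarith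
  have hd0 := hdn.ne
  have hq : 0 < (minTime (n + 1) - maxTime (n + 1)) / -drop (n + 1) := div_pos hx (by linarith)
  set q := (minTime (n + 1) - maxTime (n + 1)) / -drop (n + 1) with hqdef
  set p := drop (n + 1) / (minTime (n + 1) - maxTime (n + 1)) with hpdef
  have hpq : p * q = -1 := by rw [hqdef, hpdef]; field_simp
  have hqd : drop (n + 1) * q = -(minTime (n + 1) - maxTime (n + 1)) := by rw [hqdef]; field_simp
  have k1 : 0 ≤ (t - (maxTime (n + 1) + maxValue (n + 1))) * q :=
    mul_nonneg (by linarith [h.1]) hq.le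
  have k2 : (t - (maxTime (n + 1) + maxValue (n + 1))) * q < minTime (n + 1) - maxTime (n + 1) := by
    have : (t - (maxTime (n + 1) + maxValue (n + 1))) * q < -drop (n + 1) * q :=
      mul_lt_mul_of_pos_right (by linarith [h.2]) hq
    linarith
  have key : ∀ r ∈ Ico (maxTime (n + 1)) (minTime (n + 1)), t < r + freeBoundary r ↔
      maxTime (n + 1) + (t - (maxTime (n + 1) + maxValue (n + 1))) * q < r := by
    intro r hr
    rw [extinction_falling hr]
    have e : (maxTime (n + 1) + maxValue (n + 1) - (r - maxTime (n + 1)) * p - t) * q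
      = r - (maxTime (n + 1) + (t - (maxTime (n + 1) + maxValue (n + 1))) * q) := by
      linear_combination (-(r - maxTime (n + 1))) * hpq
    rw [← sub_pos, ← sub_pos (b := maxTime (n + 1) + _), ← e, mul_pos_iff_of_pos_right hq]
  ext r
  constructor
  · rintro ⟨⟨hr, hrt⟩, hl⟩
    refine ⟨?_, hrt⟩
    rcases lt_or_ge r (minTime n) with hA | hA
    · have := extinction_le_of_lt_minTime hr hA
      linarith [h.1]
    rcases lt_or_ge r (maxTime (n + 1)) with hB | hB
    · have := (extinction_rising ⟨hA, hB⟩).1 hl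
      have : 0 ≤ (t - (maxTime (n + 1) + maxValue (n + 1))) * (1 - slope (n + 1)) :=
        mul_nonneg (by linarith [h.1]) (by linarith)
      linarith
    rcases lt_or_ge r (minTime (n + 1)) with hC | hC
    · exact (key r ⟨hB, hC⟩).1 hl
    · linarith
  · rintro ⟨hr, hrt⟩
    have hB : maxTime (n + 1) ≤ r := by linarith
    refine ⟨⟨by linarith, hrt⟩, ?_⟩
    rcases lt_or_ge r (minTime (n + 1)) with hC | hC
    · exact (key r ⟨hB, hC⟩).2 hr
    rcases lt_or_ge r (maxTime (n + 2)) with hE | hE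
    · rw [freeBoundary_rising ⟨hC, hE⟩]
      have : 0 ≤ slope (n + 1) * (r - minTime (n + 1)) :=
        mul_nonneg (slope_pos _).le (by linarith)
      linarith [h.2]
    · have hE2 : r < minTime (n + 2) := hrt.trans_lt h.2
      have h3 := minTime_lt_maxTime_succ (n + 2)
      have h4 := extinction_falling_ge (n := n + 1) ⟨hE, hE2⟩
      simp only [add_assoc, Nat.reduceAdd] at h3 h4
      linarith [h.2]

/-- Now extinction times decrease along the previous fall, so its cells die in reverse order of
birth, from `t_{n+1}` backwards. The cells of the next rise die at the same time from `t_{n+1}`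
forwards, and a gap opens around that minimum. The three inequalities make the two intervals
disjoint and their lengths computable. -/
lemma aliveSet_of_mem_falling_of_drop_pos {n : ℕ} {t : ℝ}
    (h : t ∈ Ico (maxTime (n + 2)) (minTime (n + 2))) (hd : 0 < drop (n + 1)) :
    aliveSet freeBoundary t =
      Ioo (maxTime (n + 1) - (maxTime (n + 1) + maxValue (n + 1) - t) * (1 - slope (n + 1)))
        (maxTime (n + 1) + (maxTime (n + 1) + maxValue (n + 1) - t) *
          ((minTime (n + 1) - maxTime (n + 1)) / drop (n + 1))) ∪
      Ioc (maxTime (n + 2) - (maxTime (n + 2) + maxValue (n + 2) - t) * (1 - slope (n + 2))) t ∧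
    maxTime (n + 1) + (maxTime (n + 1) + maxValue (n + 1) - t) *
          ((minTime (n + 1) - maxTime (n + 1)) / drop (n + 1)) ≤ minTime (n + 1) ∧
    minTime (n + 1) ≤
      maxTime (n + 2) - (maxTime (n + 2) + maxValue (n + 2) - t) * (1 - slope (n + 2)) ∧
    maxTime (n + 2) - (maxTime (n + 2) + maxValue (n + 2) - t) * (1 - slope (n + 2)) ≤ t := by
  have eT := maxTime_succ_of_drop_pos hd
  have et := minTime_succ_of_drop_pos hd
  simp only [add_assoc, Nat.reduceAdd] at eT et
  have hx0 := maxTime_succ_le_minTime_succ n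
  have hD : drop (n + 1) = maxTime (n + 1) + maxValue (n + 1)
    - (minTime (n + 1) + minValue (n + 1)) := rfl
  have hn0 : 0 ≤ minTime n := n.cast_nonneg.trans (natCast_le_minTime n)
  have h1 := minTime_lt_maxTime_succ n
  have h2 := minTime_lt_maxTime_succ (n + 1)
  have h3 := minTime_lt_maxTime_succ (n + 2)
  have hb2 := (max_extinction_mem (Nat.succ_pos (n + 1))).1
  simp only [Nat.succ_eq_add_one, add_assoc, Nat.reduceAdd] at h2 h3 hb2
  have hs := slope_succ_lt_one n
  have hs2 := slope_succ_lt_one (n + 1)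
  simp only [add_assoc, Nat.reduceAdd] at hs2
  set c := (maxTime (n + 1) + maxValue (n + 1) - t) * (1 - slope (n + 1)) with hc
  set c2 := (maxTime (n + 2) + maxValue (n + 2) - t) * (1 - slope (n + 2)) with hc2
  have hc0 : 0 < c := mul_pos (by linarith [h.2]) (by linarith)
  have hc20 : 0 < c2 := mul_pos (by linarith [h.2]) (by linarith)
  -- Only `0 ≤ q`: if the previous fall was a jump then `q = 0`, and the first interval ends at
  -- `T_{n+1}`.
  have hq : 0 ≤ (minTime (n + 1) - maxTime (n + 1)) / drop (n + 1) :=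
    div_nonneg (by linarith) (by linarith)
  set q := (minTime (n + 1) - maxTime (n + 1)) / drop (n + 1) with hqdef
  have hqd : drop (n + 1) * q = minTime (n + 1) - maxTime (n + 1) := by rw [hqdef]; field_simp
  have k1 : 0 ≤ (maxTime (n + 1) + maxValue (n + 1) - t) * q := mul_nonneg (by linarith [h.2]) hq
  have k2 : (maxTime (n + 1) + maxValue (n + 1) - t) * q ≤ minTime (n + 1) - maxTime (n + 1) := by
    have : (maxTime (n + 1) + maxValue (n + 1) - t) * q ≤ drop (n + 1) * q :=
      mul_le_mul_of_nonneg_right (by linarith [h.1]) hq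
    linarith
  have hr0 : minTime n ≤ maxTime (n + 1) - c := by
    by_contra! hlt
    have := (extinction_rising (t := t) ⟨le_rfl, h1⟩).2 hlt
    rw [freeBoundary_minTime] at this
    linarith [(min_extinction_mem n).2, h.1]
  have hr2 : minTime (n + 1) ≤ maxTime (n + 2) - c2 := by
    by_contra! hlt
    have := (extinction_rising (n := n + 1) (t := t) ⟨le_rfl, h2⟩).2 hlt
    rw [freeBoundary_minTime] at this
    linarith [h.1]
  have key : ∀ r ∈ Ico (maxTime (n + 1)) (minTime (n + 1)), t < r + freeBoundary r ↔
      r < maxTime (n + 1) + (maxTime (n + 1) + maxValue (n + 1) - t) * q := by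
    intro r hr
    have hx : 0 < minTime (n + 1) - maxTime (n + 1) := by linarith [hr.1.trans_lt hr.2]
    have hq : 0 < q := div_pos hx hd
    rw [extinction_falling hr]
    have hpq : drop (n + 1) / (minTime (n + 1) - maxTime (n + 1)) * q = 1 := by
      rw [hqdef]; field_simp
    have e : (maxTime (n + 1) + maxValue (n + 1) - (r - maxTime (n + 1)) *
        (drop (n + 1) / (minTime (n + 1) - maxTime (n + 1))) - t) * q
      = (maxTime (n + 1) + (maxTime (n + 1) + maxValue (n + 1) - t) * q) - r := by
      linear_combination (-(r - maxTime (n + 1))) * hpq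
    rw [← sub_pos, ← sub_pos (b := r), ← e, mul_pos_iff_of_pos_right hq]
  refine ⟨?_, by linarith, hr2, by linarith [h.1]⟩
  ext r
  constructor
  · rintro ⟨⟨hr, hrt⟩, hl⟩
    rcases lt_or_ge r (minTime n) with hA | hA
    · linarith [extinction_le_of_lt_minTime hr hA, h.1]
    rcases lt_or_ge r (maxTime (n + 1)) with hB | hB
    · exact Or.inl ⟨(extinction_rising ⟨hA, hB⟩).1 hl, by linarith⟩
    rcases lt_or_ge r (minTime (n + 1)) with hC | hC
    · exact Or.inl ⟨by linarith, (key r ⟨hB, hC⟩).1 hl⟩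
    rcases lt_or_ge r (maxTime (n + 2)) with hE | hE
    · exact Or.inr ⟨(extinction_rising (n := n + 1) ⟨hC, hE⟩).1 hl, hrt⟩
    · exact Or.inr ⟨by linarith, hrt⟩
  · rintro (⟨hr, hr'⟩ | ⟨hr, hrt⟩)
    · refine ⟨⟨by linarith, by linarith [h.1]⟩, ?_⟩
      rcases lt_or_ge r (maxTime (n + 1)) with hB | hB
      · exact (extinction_rising ⟨by linarith, hB⟩).2 hr
      · exact (key r ⟨hB, by linarith⟩).2 hr'
    · refine ⟨⟨by linarith, hrt⟩, ?_⟩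
      rcases lt_or_ge r (maxTime (n + 2)) with hE | hE
      · exact (extinction_rising (n := n + 1) ⟨by linarith, hE⟩).2 hr
      · have hE2 : r < minTime (n + 2) := hrt.trans_lt h.2
        have h4 := extinction_falling_ge (n := n + 1) ⟨hE, hE2⟩
        simp only [add_assoc, Nat.reduceAdd] at h4
        linarith [h.2]

lemma volume_aliveSet_freeBoundary {n : ℕ} {t : ℝ}
    (h : t ∈ Ico (minTime (n + 1)) (minTime (n + 2))) :
    volume.real (aliveSet freeBoundary t) = freeBoundary t := by
  have aff := (extremaInvariant (Nat.succ_pos n)).affine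
  push_cast at aff
  simp only [Nat.succ_eq_add_one] at aff
  have q : ((n : ℝ) + 2) * slope (n + 1) = 1 := by
    unfold slope; push_cast; field_simp; ring
  have hD : drop (n + 1) = maxTime (n + 1) + maxValue (n + 1)
    - (minTime (n + 1) + minValue (n + 1)) := rfl
  have hge := freeBoundary_mem_Icc h
  rcases lt_or_ge t (maxTime (n + 2)) with h1 | h1
  · rw [aliveSet_of_mem_rising ⟨h.1, h1⟩]
    have e : t - (maxTime (n + 1) - (maxTime (n + 1) + maxValue (n + 1) - t) * (1 - slope (n + 1)))
        = freeBoundary t := by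
      rw [freeBoundary_rising (n := n + 1) ⟨h.1, h1⟩]
      linear_combination slope (n + 1) * aff - (maxValue (n + 1) - minValue (n + 1)) * q
    rw [Real.volume_real_Ioc, e, max_eq_left]
    linarith [hge.1, one_le_minValue (n + 1)]
  · have hlt := h1.trans_lt h.2
    have hfall := freeBoundary_falling (n := n + 1) ⟨h1, h.2.le⟩ hlt
    simp only [add_assoc, Nat.reduceAdd] at hfall
    rcases le_or_gt (drop (n + 1)) 0 with hd | hd
    · rw [aliveSet_of_mem_falling_of_drop_nonpos ⟨h1, h.2⟩ hd]
      have eT := maxTime_succ_of_drop_nonpos (Nat.succ_pos n) hd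
      have et := minTime_succ_of_drop_nonpos hd
      have eM := maxValue_succ_of_drop_nonpos (Nat.succ_pos n) hd
      have em := minValue_succ_of_drop_nonpos hd
      simp only [Nat.succ_eq_add_one, add_assoc, Nat.reduceAdd] at eT et eM em
      have hdn : drop (n + 1) < 0 := by linarith
      have ex : minTime (n + 2) - maxTime (n + 2) = - drop (n + 1) := by linarith
      have e : t - (maxTime (n + 1) + (t - (maxTime (n + 1) + maxValue (n + 1))) *
          ((minTime (n + 1) - maxTime (n + 1)) / -drop (n + 1))) = freeBoundary t := by
        rw [hfall, ex, eT, eM, em]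
        have : minTime (n + 1) - maxTime (n + 1) = (maxValue (n + 1) - minValue (n + 1))
          - drop (n + 1) := by linarith
        have hd0 := hdn.ne
        rw [this]
        field_simp
        ring
      rw [Real.volume_real_Ioc, e, max_eq_left]
      linarith [hge.1, one_le_minValue (n + 1)]
    · obtain ⟨hset, i1, i2, i3⟩ := aliveSet_of_mem_falling_of_drop_pos ⟨h1, h.2⟩ hd
      have eT := maxTime_succ_of_drop_pos hd
      have et := minTime_succ_of_drop_pos hd
      have eM := maxValue_succ_of_drop_pos hd
      have em := minValue_succ_of_drop_pos hd
      simp only [add_assoc, Nat.reduceAdd] at eT et eM em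
      have ex : minTime (n + 2) - maxTime (n + 2) = drop (n + 1) := by linarith
      have hs := slope_succ_lt_one n
      have j1 : 0 ≤ (maxTime (n + 1) + maxValue (n + 1) - t) *
          ((minTime (n + 1) - maxTime (n + 1)) / drop (n + 1)) :=
        mul_nonneg (by linarith [h.2]) (div_nonneg
          (by linarith [maxTime_succ_le_minTime_succ n]) hd.le)
      have j2 : 0 ≤ (maxTime (n + 1) + maxValue (n + 1) - t) * (1 - slope (n + 1)) :=
        mul_nonneg (by linarith [h.2]) (by linarith)
      rw [hset, measureReal_union ?_ measurableSet_Ioc (by simp) (by simp), Real.volume_real_Ioo,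
        Real.volume_real_Ioc, max_eq_left (by linarith), max_eq_left (by linarith), hfall, ex]
      · have eaff := maxValue_succ_eq (n + 1)
        have q2 : (1 - slope (n + 2)) * (1 + slope (n + 1)) = 1 := by
          unfold slope; push_cast; field_simp; ring
        have hval : maxTime (n + 2) + maxValue (n + 2) = minTime (n + 1) + minValue (n + 1)
            + (1 + slope (n + 1)) * (maxTime (n + 2) - minTime (n + 1)) := by
          simp only [add_assoc, Nat.reduceAdd] at eaff
          linarith
        -- The upper edge of the gap is rewritten from its starting point: it leaves `t_{n+1}` at
        -- time `T_{n+2}`.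
        have hval2 : (maxTime (n + 2) + maxValue (n + 2) - t) * (1 - slope (n + 2))
            = maxTime (n + 2) - minTime (n + 1) - (t - maxTime (n + 2)) * (1 - slope (n + 2)) := by
          rw [hval, ← eT]
          linear_combination (maxTime (n + 2) - minTime (n + 1)) * q2
        rw [hval2]
        have hd0 : drop (n + 1) ≠ 0 := hd.ne'
        have hx : minTime (n + 1) - maxTime (n + 1) = (maxValue (n + 1) - minValue (n + 1))
          - drop (n + 1) := by linarith
        have hm : maxTime (n + 1) + maxValue (n + 1) = maxTime (n + 2) + drop (n + 1) := by linarith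
        have hM : maxTime (n + 2) = minTime (n + 1) + minValue (n + 1) := eT
        rw [hx, eM, em, hm]
        field_simp
        rw [hM]
        have : minTime (n + 1) = maxTime (n + 1) + (maxValue (n + 1) - minValue (n + 1)
          - drop (n + 1)) := by linarith
        rw [this]
        ring
      · rw [Set.disjoint_left]
        rintro r ⟨_, hr⟩ ⟨hr', _⟩
        linarith

lemma riemannDatum_of_one_le {t : ℝ} (h : 1 ≤ t) : riemannDatum t = 0 := by
  simp [riemannDatum, h]

lemma riemannDatum_of_lt_one {t : ℝ} (h0 : 0 ≤ t) (h : t < 1) : riemannDatum t = 1 := by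
  simp [riemannDatum, h0, h]

lemma freeBoundary_eqn {t : ℝ} (ht : 0 ≤ t) :
    freeBoundary t = riemannDatum t + volume.real (aliveSet freeBoundary t) := by
  obtain ⟨n, hn⟩ := exists_mem_Ico_minTime ht
  cases n with
  | zero =>
    have h1 : t < 1 := by simpa [minTime_one] using hn.2
    have hset : aliveSet freeBoundary t = Icc 0 t := by
      refine (aliveSet_subset _ _).antisymm fun r hr => ⟨hr, ?_⟩
      linarith [one_le_freeBoundary hr.1, hr.1]
    rw [riemannDatum_of_lt_one ht h1, hset, Real.volume_real_Icc_of_le ht,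
      freeBoundary_rising (n := 0) ⟨hn.1, by simpa [maxTime_one] using h1⟩]
    norm_num [minValue_zero, minTime_zero, slope]
  | succ n =>
    have h1 : 1 ≤ t := by
      have := natCast_le_minTime (n + 1)
      push_cast at this
      linarith [hn.1, (n.cast_nonneg : (0 : ℝ) ≤ n)]
    rw [riemannDatum_of_one_le h1, volume_aliveSet_freeBoundary hn, zero_add]

lemma LocallyBoundedVariationOn.sub {f g : ℝ → ℝ} {s : Set ℝ}
    (hf : LocallyBoundedVariationOn f s) (hg : LocallyBoundedVariationOn g s) :
    LocallyBoundedVariationOn (fun x => f x - g x) s := by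
  intro a b ha hb
  refine ne_top_of_le_ne_top (ENNReal.add_ne_top.2 ⟨hf a b ha hb, hg a b ha hb⟩) ?_
  refine iSup_le ?_
  rintro ⟨n, u, hu, us⟩
  calc _ ≤ ∑ i ∈ Finset.range n,
        (edist (f (u (i + 1))) (f (u i)) + edist (g (u (i + 1))) (g (u i))) := by
        gcongr with i
        simp only [edist_eq_enorm_sub]
        rw [sub_sub_sub_comm]
        exact enorm_sub_le
    _ ≤ _ := by
        rw [Finset.sum_add_distrib]
        exact add_le_add (eVariationOn.sum_le hu us) (eVariationOn.sum_le hu us)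

lemma isFreeBoundary_freeBoundary : IsFreeBoundary riemannDatum freeBoundary where
  nonneg t ht := zero_le_one.trans (one_le_freeBoundary ht)
  eqn t ht := by rw [volume_eq_aliveSet, freeBoundary_eqn ht]
  locallyBV := by
    set G : ℝ → ℝ := fun t => t - freeBoundary t with hG
    -- `t - ℓ t` is the measure of the dead cells minus the datum. The dead accumulate and the datum
    -- is nonincreasing on `[0,∞)`, so `ℓ` is a difference of monotone functions.
    have hmono : MonotoneOn G (Ici 0) := by
      have hdead : ∀ t, 0 ≤ t → G t = volume.real {r | r ∈ Icc 0 t ∧ r + freeBoundary r ≤ t}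
          - riemannDatum t := by
        intro t ht
        have hm : MeasurableSet {r | r ∈ Icc 0 t ∧ r + freeBoundary r ≤ t} :=
          measurableSet_Icc.inter
            (measurableSet_le (measurable_id.add measurable_freeBoundary) measurable_const)
        have hu : aliveSet freeBoundary t ∪ {r | r ∈ Icc 0 t ∧ r + freeBoundary r ≤ t}
            = Icc 0 t := by
          ext r
          simp only [aliveSet, mem_union, mem_ofPred_eq, ← and_or_left, lt_or_ge, and_true]
        have hdis : Disjoint (aliveSet freeBoundary t)
            {r | r ∈ Icc 0 t ∧ r + freeBoundary r ≤ t} :=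
          Set.disjoint_left.2 fun r h1 h2 => not_le.2 h1.2 h2.2
        have := measureReal_union (μ := volume) hdis hm (volume_aliveSet_ne_top _ _)
          (measure_ne_top_of_subset (fun r h => h.1) (by simp : volume (Icc 0 t) ≠ ⊤))
        rw [hu, Real.volume_real_Icc_of_le ht] at this
        have := freeBoundary_eqn ht
        simp only [hG]
        linarith
      intro s hs t ht hst
      rw [hdead s hs, hdead t ht]
      have h1 : riemannDatum t ≤ riemannDatum s := by
        rcases lt_or_ge t 1 with h | h
        · rw [riemannDatum_of_lt_one ht h, riemannDatum_of_lt_one hs (hst.trans_lt h)]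
        · rw [riemannDatum_of_one_le h]
          exact indicator_nonneg (fun _ _ => zero_le_one) s
      have h2 : volume.real {r | r ∈ Icc 0 s ∧ r + freeBoundary r ≤ s}
          ≤ volume.real {r | r ∈ Icc 0 t ∧ r + freeBoundary r ≤ t} :=
        measureReal_mono (fun r h => ⟨⟨h.1.1, h.1.2.trans hst⟩, h.2.trans hst⟩)
          (measure_ne_top_of_subset (fun r h => h.1) (by simp : volume (Icc 0 t) ≠ ⊤))
      linarith
    have hid : MonotoneOn (fun t : ℝ => t) (Ici 0) := fun _ _ _ _ h => h
    have := LocallyBoundedVariationOn.sub hid.locallyBoundedVariationOn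
      hmono.locallyBoundedVariationOn
    simpa [hG] using this

/-! ### Uniqueness -/

/-- Induction over time steps of length `1/2`. The lower bound 1 on one solution is enough, and no
regularity of the other enters. -/
lemma eq_of_aliveSet_eqn {u₀ ℓ ℓ' : ℝ → ℝ}
    (h : ∀ t, 0 ≤ t → ℓ t = u₀ t + volume.real (aliveSet ℓ t))
    (h' : ∀ t, 0 ≤ t → ℓ' t = u₀ t + volume.real (aliveSet ℓ' t))
    (hone : ∀ t, 0 ≤ t → 1 ≤ ℓ t) : ∀ t, 0 ≤ t → ℓ' t = ℓ t := by
  have key : ∀ n : ℕ, ∀ t : ℝ, 0 ≤ t → t < n / 2 → ℓ' t = ℓ t := by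
    intro n
    induction n with
    | zero => intro t h0 h1; norm_num at h1; linarith
    | succ n ih =>
      set a : ℝ := n / 2 with ha
      have ha0 : 0 ≤ a := by positivity
      have hn : ((n + 1 : ℕ) : ℝ) / 2 = a + 1 / 2 := by push_cast; ring
      rw [hn]
      -- Living cells born before `a` agree for both solutions, and later births have measure at
      -- most `1/2`. So `ℓ' ≥ 1 - 1/2`, and no cell born after `a` can die before `a + 1/2`.
      have low : ∀ t, 0 ≤ t → t < a + 1 / 2 → 1 / 2 ≤ ℓ' t := by
        intro t h0 h1
        rcases lt_or_ge t a with h2 | h2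
        · rw [ih t h0 h2]; linarith [hone t h0]
        · have hsub : aliveSet ℓ t ⊆ aliveSet ℓ' t ∪ Icc a t := by
            intro r hr
            rcases lt_or_ge r a with h3 | h3
            · refine Or.inl ⟨hr.1, ?_⟩
              rw [ih r hr.1.1 h3]; exact hr.2
            · exact Or.inr ⟨h3, hr.1.2⟩
          have h3 := (measureReal_mono (μ := volume) hsub (measure_union_ne_top
            (volume_aliveSet_ne_top _ _) (by simp))).trans (measureReal_union_le _ _)
          rw [Real.volume_real_Icc_of_le h2] at h3
          linarith [h t h0, h' t h0, hone t h0]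
      intro t h0 h1
      have : aliveSet ℓ' t = aliveSet ℓ t := by
        ext r
        refine and_congr_right fun hr => ?_
        rcases lt_or_ge r a with h3 | h3
        · rw [ih r hr.1 h3]
        · have a1 := low r hr.1 (hr.2.trans_lt h1)
          have a2 := hone r hr.1
          exact iff_of_true (by linarith) (by linarith)
      rw [h t h0, h' t h0, this]
  intro t ht
  obtain ⟨n, hn⟩ := exists_nat_gt (2 * t)
  exact key n t ht (by linarith)

/-! ### The integral solution -/

/-- The source integrand at `ξ`, as a function of the time `s`, for the boundary `w`. -/
def source (w : ℝ → ℝ) (ξ s : ℝ) : ℝ := (Ioo s (w s + s)).indicator (fun _ => (1 : ℝ)) ξ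

lemma source_eq_indicator {w : ℝ → ℝ} {ξ s : ℝ} (h : s < ξ) :
    source w ξ s = {s | ξ < w s + s}.indicator (fun _ => (1 : ℝ)) s := by
  by_cases h1 : ξ < w s + s <;> simp [source, indicator, h, h1]

/-- Stated for a.e. measurable indicators because the trace of an integral solution is not assumed
measurable; only its source terms are integrable. -/
lemma integral_indicator_one_eq {τ : ℝ} (hτ : 0 ≤ τ) {E : Set ℝ}
    (hE : AEStronglyMeasurable (E.indicator fun _ => (1 : ℝ)) (volume.restrict (Ioc 0 τ))) :
    ∫ s in (0 : ℝ)..τ, E.indicator (fun _ => (1 : ℝ)) s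
      = volume.real {s | s ∈ Icc 0 τ ∧ s ∈ E} := by
  have hn : NullMeasurableSet E (volume.restrict (Ioc 0 τ)) :=
    (aemeasurable_indicator_const_iff (1 : ℝ)).1 hE.aemeasurable
  rw [intervalIntegral.integral_of_le hτ, integral_indicator₀ hn, setIntegral_const, smul_eq_mul,
    mul_one, measureReal_def, Measure.restrict_apply₀ hn, measureReal_def]
  congr 1
  rw [inter_comm]
  exact measure_congr (Ioc_ae_eq_Icc.inter (ae_eq_refl E))

lemma aestronglyMeasurable_source {w : ℝ → ℝ} {τ ξ : ℝ} (hτ : 0 ≤ τ)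
    (h : IntervalIntegrable (source w ξ) volume 0 τ) :
    AEStronglyMeasurable (source w ξ) (volume.restrict (Ioc 0 τ)) :=
  ((intervalIntegrable_iff_integrableOn_Ioc_of_le hτ).1 h).aestronglyMeasurable

lemma integral_source {w : ℝ → ℝ} {τ ξ : ℝ} (hτ : 0 < τ) (hξ : τ < ξ)
    (h : IntervalIntegrable (source w ξ) volume 0 τ) :
    ∫ s in (0 : ℝ)..τ, source w ξ s = volume.real {s | s ∈ Icc 0 τ ∧ ξ < w s + s} := by
  have heq : EqOn (source w ξ) ({s | ξ < w s + s}.indicator fun _ => (1 : ℝ)) (Ioc 0 τ) :=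
    fun s hs => source_eq_indicator (hs.2.trans_lt hξ)
  rw [intervalIntegral.integral_of_le hτ.le, setIntegral_congr_fun measurableSet_Ioc heq,
    ← intervalIntegral.integral_of_le hτ.le, integral_indicator_one_eq hτ.le]
  · rfl
  · refine (aestronglyMeasurable_source hτ.le h).congr ?_
    exact (ae_restrict_mem measurableSet_Ioc).mono heq

/-- The right trace of the integrated source is the measure of the set of living cells. -/
lemma tendsto_integral_source {w : ℝ → ℝ} {τ : ℝ} (hτ : 0 < τ)
    (h : ∀ ξ, τ < ξ → IntervalIntegrable (source w ξ) volume 0 τ) :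
    Tendsto (fun ξ => ∫ s in (0 : ℝ)..τ, source w ξ s) (𝓝[>] τ)
      (𝓝 (volume.real (aliveSet w τ))) := by
  set E : Set ℝ := {s | τ < s + w s} with hE
  have hpt : ∀ s ∈ Ioc 0 τ, Tendsto (fun ξ => source w ξ s) (𝓝[>] τ)
      (𝓝 (E.indicator (fun _ => (1 : ℝ)) s)) := by
    intro s hs
    refine tendsto_const_nhds.congr' ?_
    by_cases h1 : τ < s + w s
    · filter_upwards [Ioo_mem_nhdsGT h1] with ξ hξ
      have h2 : ξ < w s + s := by linarith [hξ.2]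
      rw [source_eq_indicator (hs.2.trans_lt hξ.1)]
      simp [indicator, hE, h1, h2]
    · filter_upwards [self_mem_nhdsWithin] with ξ hξ
      have hξ : τ < ξ := hξ
      have h2 : ¬ ξ < w s + s := by linarith
      rw [source_eq_indicator (hs.2.trans_lt hξ)]
      simp [indicator, hE, h1, h2]
  have hmeas : ∀ᶠ ξ in 𝓝[>] τ,
      AEStronglyMeasurable (source w ξ) (volume.restrict (Ioc 0 τ)) := by
    filter_upwards [self_mem_nhdsWithin] with ξ hξ
    exact aestronglyMeasurable_source hτ.le (h ξ hξ)
  -- Measurability is inherited from the sources at `ξ = τ + 1/(k+1)`, whose pointwise limit is this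
  -- indicator.
  have hEm : AEStronglyMeasurable (E.indicator fun _ => (1 : ℝ)) (volume.restrict (Ioc 0 τ)) := by
    have hpos : ∀ k : ℕ, 0 < 1 / ((k : ℝ) + 1) := fun k => by positivity
    have hseq : Tendsto (fun k : ℕ => τ + 1 / ((k : ℝ) + 1)) atTop (𝓝[>] τ) := by
      refine tendsto_nhdsWithin_iff.2 ⟨?_, Eventually.of_forall fun k => ?_⟩
      · simpa using tendsto_one_div_add_atTop_nhds_zero_nat.const_add τ
      · exact lt_add_of_pos_right τ (hpos k)
    refine aestronglyMeasurable_of_tendsto_ae atTop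
      (f := fun k : ℕ => source w (τ + 1 / ((k : ℝ) + 1))) (fun k => ?_) ?_
    · exact aestronglyMeasurable_source hτ.le (h _ (lt_add_of_pos_right τ (hpos k)))
    · filter_upwards [ae_restrict_mem measurableSet_Ioc] with s hs
      exact (hpt s hs).comp hseq
  have hval := integral_indicator_one_eq hτ.le hEm
  have hset : {s | s ∈ Icc 0 τ ∧ s ∈ E} = aliveSet w τ := rfl
  rw [← hset, ← hval]
  refine intervalIntegral.tendsto_integral_filter_of_dominated_convergence (fun _ => 1) ?_ ?_
    intervalIntegrable_const ?_
  · rwa [uIoc_of_le hτ.le]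
  · refine Eventually.of_forall fun ξ => Eventually.of_forall fun s _ => ?_
    simp only [source, indicator]
    split_ifs <;> simp
  · refine Eventually.of_forall fun s hs => hpt s ?_
    rwa [uIoc_of_le hτ.le] at hs

lemma intervalIntegrable_source {w : ℝ → ℝ} (hw : Measurable w) (ξ a b : ℝ) :
    IntervalIntegrable (source w ξ) volume a b := by
  have hm : Measurable (source w ξ) := by
    have : source w ξ = ({s | s < ξ} ∩ {s | ξ < w s + s}).indicator fun _ => (1 : ℝ) := by
      ext s
      simp [source, indicator]
    rw [this]
    exact measurable_const.indicator (measurableSet_Iio.inter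
      (measurableSet_lt measurable_const (hw.add measurable_id)))
  refine (intervalIntegrable_const (c := (1 : ℝ))).mono_fun' hm.aestronglyMeasurable
    (Eventually.of_forall fun s => ?_)
  simp only [source, indicator]
  split_ifs <;> simp

lemma riemannDatum_nonneg (x : ℝ) : 0 ≤ riemannDatum x :=
  indicator_nonneg (fun _ _ => zero_le_one) x

lemma riemannDatum_le_one (x : ℝ) : riemannDatum x ≤ 1 :=
  indicator_apply_le' (fun _ => le_rfl) fun _ => zero_le_one

lemma tendsto_riemannDatum {τ : ℝ} (hτ : 0 ≤ τ) :
    Tendsto riemannDatum (𝓝[>] τ) (𝓝 (riemannDatum τ)) := by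
  refine tendsto_const_nhds.congr' ?_
  rcases lt_or_ge τ 1 with h | h
  · filter_upwards [Ioo_mem_nhdsGT h] with ξ hξ
    rw [riemannDatum_of_lt_one hτ h, riemannDatum_of_lt_one (hτ.trans hξ.1.le) hξ.2]
  · filter_upwards [self_mem_nhdsWithin] with ξ hξ
    rw [riemannDatum_of_one_le h, riemannDatum_of_one_le (h.trans (le_of_lt hξ))]

/-- The integral solution of the Riemann problem. -/
def riemannSolution (τ ξ : ℝ) : ℝ :=
  riemannDatum ξ + ∫ s in (0 : ℝ)..τ, source freeBoundary ξ s

lemma riemannSolution_eq {τ ξ : ℝ} (hτ : 0 < τ) (hξ : τ < ξ) :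
    riemannSolution τ ξ
      = riemannDatum ξ + volume.real {s | s ∈ Icc 0 τ ∧ ξ < freeBoundary s + s} := by
  rw [riemannSolution,
    integral_source hτ hξ (intervalIntegrable_source measurable_freeBoundary _ _ _)]

lemma isIntegralSolution_riemannSolution : IsIntegralSolution riemannDatum riemannSolution where
  nonneg p hp := by
    rw [riemannSolution_eq hp.1 hp.2]
    exact add_nonneg (riemannDatum_nonneg _) measureReal_nonneg
  locallyBounded p hp := by
    refine ⟨1 + (p.1 + 1), ?_⟩
    have ho : IsOpen octant := (isOpen_lt continuous_const continuous_fst).inter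
      (isOpen_lt continuous_fst continuous_snd)
    have h1 : ∀ᶠ q : ℝ × ℝ in 𝓝 p, q.1 < p.1 + 1 :=
      continuous_fst.continuousAt.eventually_lt_const (lt_add_one p.1)
    filter_upwards [ho.mem_nhds hp, h1] with q hq hq1
    rw [riemannSolution_eq hq.1 hq.2]
    have h2 : volume.real {s | s ∈ Icc 0 q.1 ∧ q.2 < freeBoundary s + s} ≤ q.1 := by
      have := measureReal_mono (μ := volume)
        (fun s hs => hs.1 : {s | s ∈ Icc 0 q.1 ∧ q.2 < freeBoundary s + s} ⊆ Icc 0 q.1) (by simp)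
      rwa [Real.volume_real_Icc_of_le hq.1.le, sub_zero] at this
    linarith [riemannDatum_le_one q.2]
  exists_trace := by
    refine ⟨freeBoundary, fun τ hτ => ⟨zero_le_one.trans (one_le_freeBoundary hτ.le), ?_⟩,
      fun τ ξ h => ⟨intervalIntegrable_source measurable_freeBoundary _ _ _, rfl⟩⟩
    rw [freeBoundary_eqn hτ.le]
    exact (tendsto_riemannDatum hτ.le).add (tendsto_integral_source hτ
      fun ξ _ => intervalIntegrable_source measurable_freeBoundary _ _ _)

/-- The trace solves the boundary equation, hence equals `freeBoundary` for positive times, and the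
trace determines `v`. -/
lemma eq_riemannSolution {v : ℝ → ℝ → ℝ} (hv : IsIntegralSolution riemannDatum v) :
    ∀ p ∈ octant, v p.1 p.2 = riemannSolution p.1 p.2 := by
  obtain ⟨w, hw, hv⟩ := hv.exists_trace
  change ∀ τ ξ, (τ, ξ) ∈ octant → IntervalIntegrable (source w ξ) volume 0 τ ∧
    v τ ξ = riemannDatum ξ + ∫ s in (0 : ℝ)..τ, source w ξ s at hv
  have hwe : ∀ τ, 0 < τ → w τ = riemannDatum τ + volume.real (aliveSet w τ) := by
    intro τ hτ
    have h1 := (tendsto_riemannDatum hτ.le).add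
      (tendsto_integral_source hτ fun ξ hξ => (hv τ ξ ⟨hτ, hξ⟩).1)
    refine tendsto_nhds_unique (hw τ hτ).2 (h1.congr' ?_)
    filter_upwards [self_mem_nhdsWithin] with ξ hξ
    exact (hv τ ξ ⟨hτ, hξ⟩).2.symm
  -- The trace is unconstrained at time 0; the value 1 is the one the equation forces there.
  set W : ℝ → ℝ := fun t => if 0 < t then w t else 1 with hW
  have hWw : ∀ t, 0 < t → W t = w t := fun t ht => if_pos ht
  have hWe : ∀ t, 0 ≤ t → W t = riemannDatum t + volume.real (aliveSet W t) := by
    intro t ht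
    rcases ht.eq_or_lt with rfl | ht
    · have : volume.real (aliveSet W 0) = 0 := by
        refine le_antisymm ?_ measureReal_nonneg
        have := measureReal_mono (μ := volume) (aliveSet_subset W 0) (by simp)
        rwa [Real.volume_real_Icc_of_le le_rfl, sub_zero] at this
      rw [this, riemannDatum_of_lt_one le_rfl one_pos]
      simp [hW]
    · rw [hWw t ht, hwe t ht]
      congr 1
      refine measureReal_congr ?_
      have h0 : ∀ᵐ r : ℝ, r ≠ 0 := by simp [ae_iff]
      filter_upwards [h0] with r hr
      refine propext (and_congr_right fun h => ?_)
      rw [hWw r (lt_of_le_of_ne h.1 hr.symm)]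
  have hWl := eq_of_aliveSet_eqn (fun t ht => freeBoundary_eqn ht) hWe
    (fun t ht => one_le_freeBoundary ht)
  rintro ⟨τ, ξ⟩ h
  have hτ : 0 < τ := h.1
  rw [(hv τ ξ h).2, riemannSolution, intervalIntegral.integral_of_le hτ.le,
    intervalIntegral.integral_of_le hτ.le]
  congr 1
  refine setIntegral_congr_fun measurableSet_Ioc fun s hs => ?_
  simp only [source]
  rw [← hWw s hs.1, hWl s hs.1.le]

/-! ### Stationary solutions -/

lemma volume_constant_boundary {c τ ξ : ℝ} (hτ : 0 < τ) :
    volume.real {s | s ∈ Icc 0 τ ∧ ξ < c + s} = max (c - (ξ - τ)) 0 - max (c - ξ) 0 := by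
  rcases lt_or_ge (ξ - c) 0 with h1 | h1
  · have : {s | s ∈ Icc 0 τ ∧ ξ < c + s} = Icc 0 τ := by
      ext s
      refine ⟨fun h => h.1, fun h => ⟨h, by linarith [h.1]⟩⟩
    rw [this, Real.volume_real_Icc_of_le hτ.le, max_eq_left (by linarith),
      max_eq_left (by linarith)]
    ring
  · have : {s | s ∈ Icc 0 τ ∧ ξ < c + s} = Ioc (ξ - c) τ := by
      ext s
      constructor
      · rintro ⟨h2, h3⟩; exact ⟨by linarith, h2.2⟩
      · rintro ⟨h2, h3⟩; exact ⟨⟨by linarith, h3⟩, by linarith⟩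
    rw [this, Real.volume_real_Ioc, max_eq_right (a := c - ξ) (by linarith), sub_zero]
    congr 1; ring

lemma isStationary_uStat : IsStationary uStat where
  nonneg p _ := le_max_right _ _
  locallyBounded p hp := by
    refine ⟨√2, ?_⟩
    have ho : IsOpen octant := (isOpen_lt continuous_const continuous_fst).inter
      (isOpen_lt continuous_fst continuous_snd)
    filter_upwards [ho.mem_nhds hp] with q hq
    have : q.1 < q.2 := hq.2
    exact max_le (by linarith) (Real.sqrt_nonneg 2)
  exists_trace := by
    refine ⟨fun _ => √2, fun τ hτ => ⟨Real.sqrt_nonneg 2, ?_⟩, fun τ ξ h => ?_⟩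
    · have hc : Continuous fun ξ => uStat (ξ - τ) := by unfold uStat; fun_prop
      have := (hc.tendsto τ).mono_left (nhdsWithin_le_nhds (s := Ioi τ))
      simpa [uStat] using this
    · have hi := intervalIntegrable_source (measurable_const (a := √2)) ξ 0 τ
      refine ⟨hi, ?_⟩
      have h1 := integral_source h.1 h.2 hi
      rw [volume_constant_boundary h.1] at h1
      change uStat (ξ - τ) = uStat ξ + ∫ s in (0 : ℝ)..τ, source (fun _ => √2) ξ s
      rw [h1, uStat, uStat]
      ring

lemma integrableOn_ramp (c : ℝ) : IntegrableOn (fun x : ℝ => max (c - x) 0) (Ioi 0) := by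
  have h : IntegrableOn (fun x : ℝ => max (c - x) 0) (Ioc 0 c) :=
    (Continuous.integrableOn_Icc (by fun_prop)).mono_set Ioc_subset_Icc_self
  refine h.of_forall_sdiff_eq_zero measurableSet_Ioi fun x hx => ?_
  have : c < x := by
    by_contra! hle
    exact hx.2 ⟨hx.1, hle⟩
  exact max_eq_right (by linarith)

lemma integral_ramp {c : ℝ} (hc : 0 ≤ c) : ∫ x in Ioi (0 : ℝ), max (c - x) 0 = c ^ 2 / 2 := by
  have h : ∫ x in Ioc (0 : ℝ) c, max (c - x) 0 = ∫ x in Ioi (0 : ℝ), max (c - x) 0 := by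
    refine (setIntegral_eq_of_subset_of_forall_sdiff_eq_zero measurableSet_Ioi
      Ioc_subset_Ioi_self fun x hx => ?_).symm
    have : c < x := by
      by_contra! hle
      exact hx.2 ⟨hx.1, hle⟩
    exact max_eq_right (by linarith)
  have h2 : EqOn (fun x : ℝ => max (c - x) 0) (fun x => c - x) (Ioc 0 c) :=
    fun x hx => max_eq_left (by linarith [hx.2])
  rw [← h, setIntegral_congr_fun measurableSet_Ioc h2, ← intervalIntegral.integral_of_le hc,
    intervalIntegral.integral_sub (by simp) (by simp)]
  simp
  ring

lemma hasUnitMass_uStat : HasUnitMass uStat :=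
  ⟨integrableOn_ramp _, by
    have := integral_ramp (Real.sqrt_nonneg 2)
    rwa [Real.sq_sqrt zero_le_two, div_self two_ne_zero] at this⟩

/-- Stationarity makes the trace a constant `c`, namely the limit of `f` at `0⁺`. The integral
equation then says that `f x - max (c - x) 0` is translation invariant, hence constant;
integrability makes the constant zero, and unit mass gives `c ^ 2 / 2 = 1`. -/
lemma eq_uStat_of_isStationary {f : ℝ → ℝ} (hf : IsStationary f) (hm : HasUnitMass f) {x : ℝ}
    (hx : 0 < x) : f x = uStat x := by
  obtain ⟨w, hw, hv⟩ := hf.exists_trace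
  change ∀ τ ξ, (τ, ξ) ∈ octant → IntervalIntegrable (source w ξ) volume 0 τ ∧
    f (ξ - τ) = f ξ + ∫ s in (0 : ℝ)..τ, source w ξ s at hv
  have htr : ∀ τ, 0 < τ → Tendsto f (𝓝[>] 0) (𝓝 (w τ)) := by
    intro τ hτ
    have hshift : Tendsto (fun x => x + τ) (𝓝[>] (0 : ℝ)) (𝓝[>] τ) := by
      refine tendsto_nhdsWithin_iff.2 ⟨?_, ?_⟩
      · have hc : Continuous fun x : ℝ => x + τ := by fun_prop
        have := (hc.tendsto 0).mono_left (nhdsWithin_le_nhds (s := Ioi 0))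
        simpa using this
      · filter_upwards [self_mem_nhdsWithin] with x hx
        exact lt_add_of_pos_left τ hx
    have := (hw τ hτ).2.comp hshift
    simpa [Function.comp_def] using this
  set c := w 1 with hc
  have hwc : ∀ τ, 0 < τ → w τ = c := fun τ hτ => tendsto_nhds_unique (htr τ hτ) (htr 1 one_pos)
  have hc0 : 0 ≤ c := (hw 1 one_pos).1
  have hfe : ∀ x τ, 0 < x → 0 < τ → f x - max (c - x) 0 = f (x + τ) - max (c - (x + τ)) 0 := by
    intro x τ hx hτ
    have hlt : τ < x + τ := lt_add_of_pos_left τ hx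
    obtain ⟨hi, he⟩ := hv τ (x + τ) ⟨hτ, hlt⟩
    rw [integral_source hτ hlt hi, add_sub_cancel_right] at he
    have hset : volume.real {s | s ∈ Icc 0 τ ∧ x + τ < w s + s}
        = volume.real {s | s ∈ Icc 0 τ ∧ x + τ < c + s} := by
      refine measureReal_congr ?_
      have h0 : ∀ᵐ r : ℝ, r ≠ 0 := by simp [ae_iff]
      filter_upwards [h0] with r hr
      refine propext (and_congr_right fun h => ?_)
      rw [hwc r (lt_of_le_of_ne h.1 hr.symm)]
    rw [hset, volume_constant_boundary hτ, add_sub_cancel_right] at he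
    linarith
  set K := f 1 - max (c - 1) 0 with hK
  have hconst : ∀ x, 0 < x → f x - max (c - x) 0 = K := by
    intro x hx
    rw [hfe x 1 hx one_pos, hK, hfe 1 x one_pos hx, add_comm x 1]
  have hK0 : K = 0 := by
    have h1 : IntegrableOn (fun x => f x - max (c - x) 0) (Ioi 0) :=
      hm.1.sub (integrableOn_ramp c)
    have h2 : IntegrableOn (fun _ : ℝ => K) (Ioi 0) :=
      h1.congr_fun (fun x hx => hconst x hx) measurableSet_Ioi
    simpa [integrableOn_const_iff] using h2
  have hfc : ∀ x, 0 < x → f x = max (c - x) 0 := by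
    intro x hx
    linarith [hconst x hx]
  have hmass := hm.2
  rw [setIntegral_congr_fun measurableSet_Ioi (fun x hx => hfc x hx), integral_ramp hc0] at hmass
  have : c = √2 := by
    rw [← show c ^ 2 = 2 by linarith, Real.sqrt_sq hc0]
  rw [hfc x hx, uStat, this]

/-! ### Convergence to the stationary solution -/

/-- As `ℓ ≤ 2`, only cells born after `t - 2 ≥ S` count, and for those `ℓ` is within `ε` of `√2`.
The counted set lies between two intervals whose left ends differ by `ε` from `t + x - √2`. -/
lemma abs_physical_sub_uStat_le {ε S : ℝ} (hε : 0 < ε)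
    (hl : ∀ s, S ≤ s → |freeBoundary s - √2| ≤ ε) {t x : ℝ} (ht : S + 2 ≤ t) (ht2 : 2 ≤ t)
    (hx : 0 < x) : |physical riemannSolution t x - uStat x| ≤ ε := by
  rw [physical, riemannSolution_eq (by linarith) (by linarith),
    riemannDatum_of_one_le (by linarith), zero_add, uStat]
  set A := {s | s ∈ Icc 0 t ∧ t + x < freeBoundary s + s} with hA
  have hs2 : √2 ≤ 2 := Real.sqrt_le_iff.2 (by norm_num)
  have hup : A ⊆ Ioc (t + x - √2 - ε) t := by
    rintro s ⟨hs, h⟩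
    have h2 := freeBoundary_le_two hs.1
    have := abs_le.1 (hl s (by linarith))
    exact ⟨by linarith, hs.2⟩
  have hlow : Ioc (t + x - √2 + ε) t ⊆ A := by
    rintro s ⟨h1, h2⟩
    have := abs_le.1 (hl s (by linarith))
    exact ⟨⟨by linarith, h2⟩, by linarith⟩
  have h1 := measureReal_mono (μ := volume) hup (by simp)
  have h2 := measureReal_mono (μ := volume) hlow
    (measure_ne_top_of_subset hup (by simp))
  rw [Real.volume_real_Ioc] at h1 h2
  have h3 : max (t - (t + x - √2 - ε)) 0 ≤ max (√2 - x) 0 + ε :=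
    max_le (by linarith [le_max_left (√2 - x) 0]) (by linarith [le_max_right (√2 - x) 0])
  have h4 : max (√2 - x) 0 ≤ max (t - (t + x - √2 + ε)) 0 + ε :=
    max_le (by linarith [le_max_left (t - (t + x - √2 + ε)) 0])
      (by linarith [le_max_right (t - (t + x - √2 + ε)) 0])
  rw [abs_le]
  constructor <;> linarith

lemma tendsto_eLpNorm_physical_sub_uStat :
    Tendsto (fun t : ℝ => eLpNorm (fun x => physical riemannSolution t x - uStat x) ⊤
      (volume.restrict (Ici (0 : ℝ)))) atTop (𝓝 0) := by
  rw [ENNReal.tendsto_nhds_zero]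
  intro ε hε
  obtain ⟨r, hr0, hrε⟩ := ENNReal.lt_iff_exists_nnreal_btwn.1 hε
  have hr : (0 : ℝ) < r := by exact_mod_cast hr0
  obtain ⟨S, hS⟩ := Metric.tendsto_atTop.1 tendsto_freeBoundary r hr
  filter_upwards [eventually_ge_atTop (S + 2), eventually_ge_atTop 2] with t ht ht2
  refine le_trans ?_ hrε.le
  rw [eLpNorm_exponent_top, ← ENNReal.ofReal_coe_nnreal]
  refine eLpNormEssSup_le_of_ae_bound ?_
  -- The point `x = 0` lies outside the octant but has measure zero.
  rw [← restrict_Ioi_eq_restrict_Ici]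
  filter_upwards [ae_restrict_mem measurableSet_Ioi] with x hx
  exact abs_physical_sub_uStat_le hr (fun s hs => (hS s hs).le) ht ht2 hx

end SingularTransport

end

theorem mainTheorem5 :
    ∃ (ℓ : ℝ → ℝ) (v : ℝ → ℝ → ℝ),
      -- `ℓ` is the free boundary function of the Riemann problem, `v` its integral solution
      (SingularTransport.IsFreeBoundary SingularTransport.riemannDatum ℓ ∧
        ∀ ℓ' : ℝ → ℝ, SingularTransport.IsFreeBoundary SingularTransport.riemannDatum ℓ' →
          ∀ t, 0 ≤ t → ℓ' t = ℓ t) ∧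
      (SingularTransport.IsIntegralSolution SingularTransport.riemannDatum v ∧
        ∀ v' : ℝ → ℝ → ℝ,
          SingularTransport.IsIntegralSolution SingularTransport.riemannDatum v' →
          ∀ p ∈ SingularTransport.octant, v' p.1 p.2 = v p.1 p.2) ∧
      -- the local minima and maxima of `ℓ` and their limits
      SingularTransport.HasAlternatingExtrema ℓ
        SingularTransport.minTime SingularTransport.minValue
        SingularTransport.maxTime SingularTransport.maxValue ∧
      Tendsto SingularTransport.maxValue atTop (𝓝 (Real.sqrt 2)) ∧
      Tendsto SingularTransport.minValue atTop (𝓝 (Real.sqrt 2)) ∧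
      -- `uStat` is the stationary solution with unit mass
      (SingularTransport.IsStationary SingularTransport.uStat ∧
        SingularTransport.HasUnitMass SingularTransport.uStat ∧
        ∀ f : ℝ → ℝ, SingularTransport.IsStationary f → SingularTransport.HasUnitMass f →
          ∀ x, 0 < x → f x = SingularTransport.uStat x) ∧
      -- convergence in `L^∞`
      Tendsto
        (fun t : ℝ => eLpNorm
          (fun x => SingularTransport.physical v t x - SingularTransport.uStat x) ⊤
          (volume.restrict (Ici (0 : ℝ))))
        atTop (𝓝 0) := by
  refine ⟨SingularTransport.freeBoundary, SingularTransport.riemannSolution,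
    ⟨SingularTransport.isFreeBoundary_freeBoundary, fun ℓ' h => ?_⟩,
    ⟨SingularTransport.isIntegralSolution_riemannSolution,
      fun v' h => SingularTransport.eq_riemannSolution h⟩,
    SingularTransport.hasAlternatingExtrema_freeBoundary, SingularTransport.tendsto_maxValue,
    SingularTransport.tendsto_minValue,
    ⟨SingularTransport.isStationary_uStat, SingularTransport.hasUnitMass_uStat,
      fun f hf hm x hx => SingularTransport.eq_uStat_of_isStationary hf hm hx⟩,
    SingularTransport.tendsto_eLpNorm_physical_sub_uStat⟩
  refine SingularTransport.eq_of_aliveSet_eqn (fun t ht => SingularTransport.freeBoundary_eqn ht)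
    (fun t ht => ?_) (fun t ht => SingularTransport.one_le_freeBoundary ht)
  rw [← SingularTransport.volume_eq_aliveSet, ← h.eqn t ht]
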